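/- **Setting.** Let $n\ge 0$, $\varepsilon_0>0$. Let $X=X_1\times X_2$, where $X_1\subset\mathbb R$ is an open interval containing $0$ and $X_2\subset\mathbb R^n$ is open and homeomorphic to an open ball, and let $x^*=(x_1^*,x_2^*)\in X$ with $x_1^*>0$. For $\varepsilon\in[0,\varepsilon_0)$ consider the single-mode hybrid system with * vector field $\dot x=F(x)=e_1+\varepsilon\,(F_1(x),F_2(x))$ on $X$, where $F_1$ and $F_2$ (with values in $\mathbb R$ and $\mathbb R^n$) may depend on $\varepsilon$ and are $C^2$ in $(\varepsilon,x)$; * guard $G=\gamma^{-1}(0)$, where $\gamma:X\to\mathbb R$ may depend on $\varepsilon$ and is $C^1$ in $(\varepsilon,x)$, with $x^*\in G$ and $\partial_{x_1}\gamma\neq0$ on $G$ for every $\varepsilon$; for $\varepsilon=0$ the points $(s,x_2^*)$, $0\le s<x_1^*$, are not on the guard; * reset map $R:G\to X$, which may depend on $\varepsilon$ and is $C^2$ in $(\varepsilon,x)$, with $\pi_1R\equiv 0$ and $\pi_2R(x^*)=x_2^*$ for every $\varepsilon$. A trajectory flows along $F$ until it first meets $G$, and is then reset by $R$. Let $\Phi$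 be the flow of $F$, let $\tau(x)$ be the signed time (near $0$) at which the trajectory of a point $x$ near $x^*$ crosses $G$, and put $$\bar R(x_2)=\pi_2R\big(\Phi(\tau(x_1^*,x_2),(x_1^*,x_2))\big),\qquad \bar f(x_2)=\frac1{x_1^*}\int_0^{x_1^*}F_2(\sigma,x_2)\big|_{\varepsilon=0}\,d\sigma .$$ The system is *averageable at $x^*$* if moreover $\bar f(x_2^*)=0$ and $$D\bar R(x_2)=S_0+\varepsilon S_1(x_2)+O(\varepsilon^2)\quad(\varepsilon\to0^+),\ \text{uniformly for } x_2 \text{ near } x_2^*,$$ with a constant matrix $S_0$ and a matrix function $S_1$ continuous at $x_2^*$, such that $S_0$ is invertible, the Jordan blocks of $S_0$ to the eigenvalue $1$ are diagonal, and $S_1(x_2^*)+x_1^*S_0D\bar f(x_2^*)$ is invertible. It *has orthogonal reset* if $S_0$ is an orthogonal matrix and $$W(x_2^*):=S_0^{T}S_1(x_2^*)+x_1^*D\bar f(x_2^*)$$ is invertible. A *periodic orbit* $\Gamma$ is the closed trajectory segment from a point $y\in X$ to the point $q$ where its trajectory first meets $G$, at a positive time, provided that $R(q)=y$. It is *exponentially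 stable* if there are $\delta,M,r>0$ such that from each state $x$ with $\operatorname{dist}(x,\Gamma)<\delta$ that is not beyond the guard (that is, $x\in X$ and $\gamma(x)\gamma(0,x_2^*)\ge0$) a hybrid execution with infinitely many resets exists for all time, and every hybrid execution with infinitely many resets from $x$ satisfies $\operatorname{dist}(x(t),\Gamma)\le Me^{-rt}\operatorname{dist}(x,\Gamma)$ (also at the guard points before the resets). **Corollary (stability of averageable hybrid systems with orthogonal reset).** Suppose that the system is averageable at $x^*$ and has orthogonal reset. If $W(x_2^*)^T+W(x_2^*)$ is negative definite, then there is $\varepsilon_1>0$ such that for every $\varepsilon\in(0,\varepsilon_1)$ the system has an exponentially stable periodic orbit. -/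

import Mathlib

open Set Filter Topology

/-- The data of an `ε`-parameterized single-mode hybrid system on `X₁ × X₂ ⊆ ℝ × ℝⁿ`; the first
argument of `F₁`, `F₂`, `γ`, `R` is `ε`.  Only the values on `X₁ × X₂` (of `R`: on the guard)
are meaningful. -/
structure SingleModeSystem (n : ℕ) where
  /-- the phase interval -/
  X₁ : Set ℝ
  /-- the set of slow coordinates -/
  X₂ : Set (EuclideanSpace ℝ (Fin n))
  /-- the perturbation of the phase velocity -/
  F₁ : ℝ → ℝ × EuclideanSpace ℝ (Fin n) → ℝ
  /-- the perturbation of the slow velocity -/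
  F₂ : ℝ → ℝ × EuclideanSpace ℝ (Fin n) → EuclideanSpace ℝ (Fin n)
  /-- the function whose zero set is the guard -/
  γ : ℝ → ℝ × EuclideanSpace ℝ (Fin n) → ℝ
  /-- the reset map -/
  R : ℝ → ℝ × EuclideanSpace ℝ (Fin n) → ℝ × EuclideanSpace ℝ (Fin n)
  /-- the phase component of the base point `x*` -/
  x₁ : ℝ
  /-- the slow component of the base point `x*` -/
  x₂ : EuclideanSpace ℝ (Fin n)

namespace SingleModeSystem

variable {n : ℕ}

/-- The state space `X = X₁ × X₂`. -/
def X (H : SingleModeSystem n) : Set (ℝ × EuclideanSpace ℝ (Fin n)) := H.X₁ ×ˢ H.X₂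

/-- The vector field `F = e₁ + ε (F₁, F₂)`. -/
def F (H : SingleModeSystem n) (ε : ℝ) (x : ℝ × EuclideanSpace ℝ (Fin n)) :
    ℝ × EuclideanSpace ℝ (Fin n) :=
  (1 + ε * H.F₁ ε x, ε • H.F₂ ε x)

/-- The guard `G = γ⁻¹(0)`. -/
def guard (H : SingleModeSystem n) (ε : ℝ) : Set (ℝ × EuclideanSpace ℝ (Fin n)) :=
  {x ∈ H.X | H.γ ε x = 0}

/-- The averaged vector field. -/
noncomputable def avg (H : SingleModeSystem n) (x : EuclideanSpace ℝ (Fin n)) :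
    EuclideanSpace ℝ (Fin n) :=
  (1 / H.x₁) • ∫ σ in (0 : ℝ)..H.x₁, H.F₂ 0 (σ, x)

/-- `y = Φ(t, x)` for the maximal flow `Φ` of `F` in `X`; the time `t` may be negative. -/
def FlowsTo (H : SingleModeSystem n) (ε t : ℝ) (x y : ℝ × EuclideanSpace ℝ (Fin n)) : Prop :=
  ∃ c : ℝ → ℝ × EuclideanSpace ℝ (Fin n), c 0 = x ∧ c t = y ∧
    ∀ s ∈ uIcc 0 t, c s ∈ H.X ∧ HasDerivWithinAt c (H.F ε (c s)) (uIcc 0 t) s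

/-- The maximal flow `Φ(t, x)` (an arbitrary value where it is undefined). -/
noncomputable def flow (H : SingleModeSystem n) (ε t : ℝ)
    (x : ℝ × EuclideanSpace ℝ (Fin n)) : ℝ × EuclideanSpace ℝ (Fin n) :=
  Classical.epsilon (H.FlowsTo ε t x)

/-- The signed time-to-event map: the time `t`, of either sign, that is nearest to `0` with
`γ (Φ(t, x)) = 0`.  Near a transverse point of the guard this is the solution `t = τ(x)` near `0`
given by the implicit function theorem. -/
noncomputable def timeToGuard (H : SingleModeSystem n) (ε : ℝ)
    (x : ℝ × EuclideanSpace ℝ (Fin n)) : ℝ :=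
  Classical.epsilon fun t : ℝ =>
    (∃ y ∈ H.guard ε, H.FlowsTo ε t x y) ∧
      ∀ s : ℝ, (∃ z ∈ H.guard ε, H.FlowsTo ε s x z) → |t| ≤ |s|

/-- The slow reset map `R̄(x₂) = π₂ (R (Φ(τ(x₁*, x₂), (x₁*, x₂))))`. -/
noncomputable def slowReset (H : SingleModeSystem n) (ε : ℝ) (x : EuclideanSpace ℝ (Fin n)) :
    EuclideanSpace ℝ (Fin n) :=
  (H.R ε (H.flow ε (H.timeToGuard ε (H.x₁, x)) (H.x₁, x))).2

/-- `H`, for `0 ≤ ε < ε₀`, is averageable at `x* = (x₁*, x₂*)`, where the derivative of the slow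
reset map is `S₀ + ε S₁(x₂) + O(ε²)`. -/
structure IsAverageable (H : SingleModeSystem n) (ε₀ : ℝ)
    (S₀ : EuclideanSpace ℝ (Fin n) →L[ℝ] EuclideanSpace ℝ (Fin n))
    (S₁ : EuclideanSpace ℝ (Fin n) → EuclideanSpace ℝ (Fin n) →L[ℝ] EuclideanSpace ℝ (Fin n)) :
    Prop where
  ε₀_pos : 0 < ε₀
  -- the state space: an open interval around the origin times a topological ball
  isOpen_X₁ : IsOpen H.X₁
  ordConnected_X₁ : H.X₁.OrdConnected
  zero_mem_X₁ : (0 : ℝ) ∈ H.X₁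
  isOpen_X₂ : IsOpen H.X₂
  ball_X₂ : Nonempty (H.X₂ ≃ₜ Metric.ball (0 : EuclideanSpace ℝ (Fin n)) 1)
  -- the base point
  x₁_mem : H.x₁ ∈ H.X₁
  x₁_pos : 0 < H.x₁
  x₂_mem : H.x₂ ∈ H.X₂
  -- the continuous dynamics
  contDiffOn_F₁ : ContDiffOn ℝ 2
    (fun p : ℝ × (ℝ × EuclideanSpace ℝ (Fin n)) => H.F₁ p.1 p.2) (Ico 0 ε₀ ×ˢ H.X)
  contDiffOn_F₂ : ContDiffOn ℝ 2
    (fun p : ℝ × (ℝ × EuclideanSpace ℝ (Fin n)) => H.F₂ p.1 p.2) (Ico 0 ε₀ ×ˢ H.X)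
  avg_eq_zero : H.avg H.x₂ = 0
  -- the guard
  contDiffOn_γ : ContDiffOn ℝ 1
    (fun p : ℝ × (ℝ × EuclideanSpace ℝ (Fin n)) => H.γ p.1 p.2) (Ico 0 ε₀ ×ˢ H.X)
  mem_guard : ∀ ε ∈ Ico 0 ε₀, (H.x₁, H.x₂) ∈ H.guard ε
  transverse : ∀ ε ∈ Ico 0 ε₀, ∀ x ∈ H.guard ε, fderiv ℝ (H.γ ε) x (1, 0) ≠ 0
  -- at `ε = 0` the guard is not met on the way from `(0, x₂*)` to `x*`
  not_mem_guard : ∀ s ∈ Ico 0 H.x₁, (s, H.x₂) ∉ H.guard 0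
  -- the reset
  mapsTo_R : ∀ ε ∈ Ico 0 ε₀, MapsTo (H.R ε) (H.guard ε) H.X
  contDiffOn_R : ContDiffOn ℝ 2
    (fun p : ℝ × (ℝ × EuclideanSpace ℝ (Fin n)) => H.R p.1 p.2)
    {p | p.1 ∈ Ico 0 ε₀ ∧ p.2 ∈ H.guard p.1}
  fst_R : ∀ ε ∈ Ico 0 ε₀, ∀ x ∈ H.guard ε, (H.R ε x).1 = 0
  snd_R : ∀ ε ∈ Ico 0 ε₀, (H.R ε (H.x₁, H.x₂)).2 = H.x₂
  -- the expansion of the derivative of the slow reset map, uniformly near `x₂*`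
  differentiableAt_slowReset : ∀ᶠ p in 𝓝[≥] (0 : ℝ) ×ˢ 𝓝 H.x₂,
    DifferentiableAt ℝ (H.slowReset p.1) p.2
  expansion_slowReset :
    (fun p : ℝ × EuclideanSpace ℝ (Fin n) =>
        fderiv ℝ (H.slowReset p.1) p.2 - (S₀ + p.1 • S₁ p.2))
      =O[𝓝[≥] (0 : ℝ) ×ˢ 𝓝 H.x₂] fun p => p.1 ^ 2
  continuousAt_S₁ : ContinuousAt S₁ H.x₂
  isUnit_S₀ : IsUnit S₀
  -- the Jordan blocks of `S₀` to the eigenvalue `1` are diagonal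
  jordan_S₀ : Module.End.maxGenEigenspace (S₀ : Module.End ℝ (EuclideanSpace ℝ (Fin n))) 1 =
    Module.End.eigenspace (S₀ : Module.End ℝ (EuclideanSpace ℝ (Fin n))) 1
  isUnit_first_order : IsUnit (S₁ H.x₂ + H.x₁ • (S₀ * fderiv ℝ H.avg H.x₂))

/-- `W(x₂*) = S₀ᵀ S₁(x₂*) + x₁* D f̄(x₂*)`. -/
noncomputable def W (H : SingleModeSystem n)
    (S₀ : EuclideanSpace ℝ (Fin n) →L[ℝ] EuclideanSpace ℝ (Fin n))
    (S₁ : EuclideanSpace ℝ (Fin n) → EuclideanSpace ℝ (Fin n) →L[ℝ] EuclideanSpace ℝ (Fin n)) :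
    EuclideanSpace ℝ (Fin n) →L[ℝ] EuclideanSpace ℝ (Fin n) :=
  ContinuousLinearMap.adjoint S₀ * S₁ H.x₂ + H.x₁ • fderiv ℝ H.avg H.x₂

/-- The reset is orthogonal: `S₀` is orthogonal (`unitary` over `ℝ`) and `W(x₂*)` is
invertible. -/
structure HasOrthogonalReset (H : SingleModeSystem n)
    (S₀ : EuclideanSpace ℝ (Fin n) →L[ℝ] EuclideanSpace ℝ (Fin n))
    (S₁ : EuclideanSpace ℝ (Fin n) → EuclideanSpace ℝ (Fin n) →L[ℝ] EuclideanSpace ℝ (Fin n)) :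
    Prop where
  orthogonal : S₀ ∈ unitary (EuclideanSpace ℝ (Fin n) →L[ℝ] EuclideanSpace ℝ (Fin n))
  isUnit_W : IsUnit (H.W S₀ S₁)

/-- `c` on `[0, T]` is a trajectory in `X` that first meets the guard at time `T`
(`T = 0` if it starts on the guard). -/
structure IsArc (H : SingleModeSystem n) (ε T : ℝ)
    (c : ℝ → ℝ × EuclideanSpace ℝ (Fin n)) : Prop where
  nonneg : 0 ≤ T
  mem : ∀ s ∈ Icc 0 T, c s ∈ H.X
  hasDeriv : ∀ s ∈ Icc 0 T, HasDerivWithinAt c (H.F ε (c s)) (Icc 0 T) s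
  not_mem_guard : ∀ s ∈ Ico 0 T, c s ∉ H.guard ε
  mem_guard : c T ∈ H.guard ε

/-- A hybrid execution from `x`: it flows along the `k`-th arc `c k` for the time `T k` until the
guard is met, is then reset by `R`, and so on, for ever. -/
structure IsExecution (H : SingleModeSystem n) (ε : ℝ) (x : ℝ × EuclideanSpace ℝ (Fin n))
    (T : ℕ → ℝ) (c : ℕ → ℝ → ℝ × EuclideanSpace ℝ (Fin n)) : Prop where
  init : c 0 0 = x
  arc : ∀ k, H.IsArc ε (T k) (c k)
  reset : ∀ k, c (k + 1) 0 = H.R ε (c k (T k))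

/-- `Γ` is a periodic orbit of the hybrid system (with one reset per period). -/
def IsPeriodicOrbit (H : SingleModeSystem n) (ε : ℝ)
    (Γ : Set (ℝ × EuclideanSpace ℝ (Fin n))) : Prop :=
  ∃ (T : ℝ) (c : ℝ → ℝ × EuclideanSpace ℝ (Fin n)), 0 < T ∧ H.IsArc ε T c ∧
    H.R ε (c T) = c 0 ∧ Γ = c '' Icc 0 T

/-- The states that are not beyond the guard: those on the guard, and those on the same side of it
as the reset state `(0, x₂*)`. -/
def preGuard (H : SingleModeSystem n) (ε : ℝ) : Set (ℝ × EuclideanSpace ℝ (Fin n)) :=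
  {x ∈ H.X | 0 ≤ H.γ ε x * H.γ ε (0, H.x₂)}

/-- Exponential (orbital) stability of `Γ`: each state close to `Γ` and not beyond the guard has an
execution for all time, and every execution from it converges to `Γ` exponentially. -/
def IsExponentiallyStable (H : SingleModeSystem n) (ε : ℝ)
    (Γ : Set (ℝ × EuclideanSpace ℝ (Fin n))) : Prop :=
  ∃ δ > 0, ∃ M > 0, ∃ r > 0, ∀ x ∈ H.preGuard ε, Metric.infDist x Γ < δ →
    (∃ T c, H.IsExecution ε x T c ∧
      Tendsto (fun k => ∑ j ∈ Finset.range k, T j) atTop atTop) ∧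
    ∀ T c, H.IsExecution ε x T c → ∀ k, ∀ s ∈ Icc 0 (T k),
      Metric.infDist (c k s) Γ ≤
        M * Real.exp (-r * ((∑ j ∈ Finset.range k, T j) + s)) * Metric.infDist x Γ

end SingleModeSystem

/-! For small `ε` the phase speed `1 + ε F₁` lies between `1/2` and `3/2`, so near the segment from
`(0, x₂*)` to `x*` time can be eliminated: a trajectory is a graph `σ ↦ (σ, y σ)` with `y' = ε F₂ /
(1 + ε F₁)`. In a tube around the segment, of a width that does not depend on `ε`, every such graph
crosses the guard exactly once and transversally (`exists_hit`). The reset puts the phase back to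
`0`, and `slowReset` absorbs the gap between the crossing and the phase `x₁*` (`slowReset_eq`), so
the return map on the slow coordinates is `P : y 0 ↦ R̄ (y x₁*)`.

Let `u` be the difference of two starts and `M = x₁* D f̄(x₂*)`. The flow sends `u` to `u + ε M u`
up to `o(ε) ‖u‖` (`norm_sub_sub_le`), and `R̄` acts as `S₀ + ε S₁` up to `o(ε)`. Since `S₀ S₀ᵀ = 1`,
the product is `S₀ (1 + ε W)` to first order. The factor `S₀` is an isometry, and the negative
symmetric part of `W` makes `1 + ε W` shrink norms by `1 - ε c / 2`. Hence `P` contracts with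
constant `q = 1 - ε c / 4` (`norm_le_of_first_order`).

Because `f̄(x₂*) = 0` and `R̄` fixes `x₂*`, the map `P` moves `x₂*` by only `o(ε)`
(`norm_base_sub_le`), less than `(1 - q)` times the radius of a fixed ball. So `P` has a fixed point
there, whose trajectory is the periodic orbit. Slow deviations shrink by `q` per reset while the
time between resets is bounded, which is exponential stability (`exists_stable`). -/

section ODE

/-! ### Integral curves, and small time-dependent fields on a ball. -/

variable {E : Type*} [NormedAddCommGroup E] [NormedSpace ℝ E]

/-- A continuous scalar field between `1/2` and `3/2` has global integral curves. -/
theorem exists_scalar_integralCurve {h : ℝ → ℝ} (hc : Continuous h) (h1 : ∀ x, 1 / 2 ≤ h x)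
    (h2 : ∀ x, h x ≤ 3 / 2) (s₀ : ℝ) :
    ∃ σ : ℝ → ℝ, σ 0 = s₀ ∧ ∀ t, HasDerivAt σ (h (σ t)) t := by
  have hpos : ∀ x, 0 < h x := fun x => by linarith [h1 x]
  have hci : Continuous fun x => (h x)⁻¹ := hc.inv₀ fun x => (hpos x).ne'
  -- Separation of variables: `θ x` is the time needed to travel from `s₀` to `x`. Its slope is at
  -- least `2/3`, so it is a bijection of `ℝ`, and its inverse is the integral curve.
  set θ : ℝ → ℝ := fun x => ∫ u in s₀..x, (h u)⁻¹ with hθ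
  have hd : ∀ x, HasDerivAt θ (h x)⁻¹ x := fun x =>
    intervalIntegral.integral_hasDerivAt_right (hci.intervalIntegrable _ _)
      hci.aestronglyMeasurable.stronglyMeasurableAtFilter hci.continuousAt
  have hdiff : Differentiable ℝ θ := fun x => (hd x).differentiableAt
  have hmono : StrictMono θ := strictMono_of_deriv_pos fun x => by
    rw [(hd x).deriv]; exact inv_pos.2 (hpos x)
  have hge : ∀ x y, x ≤ y → (2 / 3) * (y - x) ≤ θ y - θ x := fun x y hxy =>
    mul_sub_le_image_sub_of_le_deriv hdiff (fun x => by
      rw [(hd x).deriv, show (2 / 3 : ℝ) = (3 / 2)⁻¹ by norm_num]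
      exact inv_anti₀ (hpos x) (h2 x)) hxy
  have h0 : θ s₀ = 0 := by simp [hθ]
  have hsurj : Function.Surjective θ := by
    refine hdiff.continuous.surjective ?_ ?_
    · refine tendsto_atTop_mono' _ (f₁ := fun x => (2 / 3) * (x - s₀)) ?_ ?_
      · filter_upwards [eventually_ge_atTop s₀] with x hx
        have := hge _ _ hx
        linarith
      · exact (tendsto_atTop_add_const_right _ _ tendsto_id).const_mul_atTop (by norm_num)
    · refine tendsto_atBot_mono' (f₂ := θ) (f₁ := fun x => (2 / 3) * (x - s₀)) _ ?_ ?_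
      · filter_upwards [eventually_le_atBot s₀] with x hx
        have := hge _ _ hx
        linarith
      · exact (tendsto_atBot_add_const_right _ _ tendsto_id).const_mul_atBot (by norm_num)
  let e := hmono.orderIsoOfSurjective θ hsurj
  have he : ∀ t, θ (e.symm t) = t := fun t => e.apply_symm_apply t
  refine ⟨e.symm, ?_, fun t => ?_⟩
  · rw [OrderIso.symm_apply_eq]; exact h0.symm
  · have := HasDerivAt.of_local_left_inverse (g := e.symm) (a := t) e.symm.continuous.continuousAt
      (hd _) (inv_ne_zero (hpos _).ne') (Eventually.of_forall he)
    simpa using this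

/-- Integral curves of a `C¹` vector field on an open set that agree at one end of an interval
agree on the interval. -/
theorem integralCurve_eqOn {U : Set E} (hU : IsOpen U) {v : E → E} (hv : ContDiffOn ℝ 1 v U)
    {a b : ℝ} {f g : ℝ → E}
    (hf : ∀ t ∈ Icc a b, f t ∈ U ∧ HasDerivWithinAt f (v (f t)) (Icc a b) t)
    (hg : ∀ t ∈ Icc a b, g t ∈ U ∧ HasDerivWithinAt g (v (g t)) (Icc a b) t)
    (h : f a = g a ∨ f b = g b) : EqOn f g (Icc a b) := by
  have hfc : ContinuousOn f (Icc a b) := fun t ht => (hf t ht).2.continuousWithinAt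
  have hgc : ContinuousOn g (Icc a b) := fun t ht => (hg t ht).2.continuousWithinAt
  -- A `C¹` field is only locally Lipschitz; on the compact union of the two traces one constant
  -- serves, which is all that uniqueness needs.
  obtain ⟨K, hK⟩ : ∃ K, LipschitzOnWith K v (f '' Icc a b ∪ g '' Icc a b) := by
    refine LocallyLipschitzOn.exists_lipschitzOnWith_of_compact
      ((isCompact_Icc.image_of_continuousOn hfc).union (isCompact_Icc.image_of_continuousOn hgc)) ?_
    intro x hx
    have hxU : x ∈ U := by
      rcases hx with ⟨t, ht, rfl⟩ | ⟨t, ht, rfl⟩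
      exacts [(hf t ht).1, (hg t ht).1]
    obtain ⟨K, t, ht, hl⟩ := (hv.contDiffAt (hU.mem_nhds hxU)).exists_lipschitzOnWith
    exact ⟨K, t, mem_nhdsWithin_of_mem_nhds ht, hl⟩
  rcases h with h | h
  · refine ODE_solution_unique_of_mem_Icc_right (v := fun _ => v)
      (s := fun _ => f '' Icc a b ∪ g '' Icc a b) (fun _ _ => hK) hfc (fun t ht => ?_)
      (fun t ht => Or.inl ⟨t, Ico_subset_Icc_self ht, rfl⟩) hgc (fun t ht => ?_)
      (fun t ht => Or.inr ⟨t, Ico_subset_Icc_self ht, rfl⟩) h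
    · exact (hf t (Ico_subset_Icc_self ht)).2.mono_of_mem_nhdsWithin (Icc_mem_nhdsGE_of_mem ht)
    · exact (hg t (Ico_subset_Icc_self ht)).2.mono_of_mem_nhdsWithin (Icc_mem_nhdsGE_of_mem ht)
  · refine ODE_solution_unique_of_mem_Icc_left (v := fun _ => v)
      (s := fun _ => f '' Icc a b ∪ g '' Icc a b) (fun _ _ => hK) hfc (fun t ht => ?_)
      (fun t ht => Or.inl ⟨t, Ioc_subset_Icc_self ht, rfl⟩) hgc (fun t ht => ?_)
      (fun t ht => Or.inr ⟨t, Ioc_subset_Icc_self ht, rfl⟩) h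
    · exact (hf t (Ioc_subset_Icc_self ht)).2.mono_of_mem_nhdsWithin (Icc_mem_nhdsLE_of_mem ht)
    · exact (hg t (Ioc_subset_Icc_self ht)).2.mono_of_mem_nhdsWithin (Icc_mem_nhdsLE_of_mem ht)

/-- A small time-dependent vector field `v` on `[α, β] × closedBall x₀ (2ρ)`. -/
structure IsSlowField (v : ℝ → E → E) (α β : ℝ) (x₀ : E) (ρ B L : ℝ) : Prop where
  le : α ≤ β
  ρ_pos : 0 < ρ
  B_nonneg : 0 ≤ B
  L_nonneg : 0 ≤ L
  continuousOn : ∀ y ∈ Metric.closedBall x₀ (2 * ρ), ContinuousOn (fun σ => v σ y) (Icc α β)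
  bound : ∀ σ ∈ Icc α β, ∀ y ∈ Metric.closedBall x₀ (2 * ρ), ‖v σ y‖ ≤ B
  lipschitz : ∀ σ ∈ Icc α β, ∀ y ∈ Metric.closedBall x₀ (2 * ρ),
    ∀ z ∈ Metric.closedBall x₀ (2 * ρ), ‖v σ y - v σ z‖ ≤ L * ‖y - z‖
  B_small : B * (β - α) ≤ ρ / 8
  L_small : L * (β - α) ≤ 1 / 2

/-- `y` solves `y' = v(σ, y)` on `[α, β]` and stays in `closedBall x₀ r`. -/
def IsSlowSol (v : ℝ → E → E) (α β : ℝ) (x₀ : E) (r : ℝ) (y : ℝ → E) : Prop :=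
  ∀ σ ∈ Icc α β, y σ ∈ Metric.closedBall x₀ r ∧ HasDerivWithinAt y (v σ (y σ)) (Icc α β) σ

theorem IsSlowSol.continuousOn {v : ℝ → E → E} {α β r : ℝ} {x₀ : E} {y : ℝ → E}
    (hy : IsSlowSol v α β x₀ r y) : ContinuousOn y (Icc α β) :=
  fun t ht => (hy t ht).2.continuousWithinAt

namespace IsSlowField

variable {v : ℝ → E → E} {α β ρ B L : ℝ} {x₀ : E}

/-- Picard–Lindelöf: the total drift is at most `ρ / 8`, so a start in the ball of radius `ρ` cannot
leave the one of radius `2ρ`. The initial phase `s` is arbitrary, so the solution runs both forwards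
and backwards. -/
theorem exists_sol [CompleteSpace E] (hv : IsSlowField v α β x₀ ρ B L) {s : ℝ} (hs : s ∈ Icc α β)
    {b : E} (hb : b ∈ Metric.closedBall x₀ ρ) :
    ∃ y, y s = b ∧ IsSlowSol v α β x₀ (2 * ρ) y := by
  have hρ := hv.ρ_pos
  obtain ⟨r, rfl⟩ : ∃ r : NNReal, (r : ℝ) = ρ := ⟨⟨ρ, hρ.le⟩, rfl⟩
  obtain ⟨B', rfl⟩ : ∃ r : NNReal, (r : ℝ) = B := ⟨⟨B, hv.B_nonneg⟩, rfl⟩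
  obtain ⟨L', rfl⟩ : ∃ r : NNReal, (r : ℝ) = L := ⟨⟨L, hv.L_nonneg⟩, rfl⟩
  obtain ⟨a, ha⟩ : ∃ a : NNReal, (a : ℝ) = 2 * r := ⟨2 * r, by simp⟩
  have hpl : IsPicardLindelof v (⟨s, hs⟩ : Icc α β) x₀ a r B' L' := by
    refine ⟨fun t ht => ?_, by rw [ha]; exact hv.continuousOn, by rw [ha]; exact hv.bound, ?_⟩
    · refine LipschitzOnWith.of_dist_le_mul fun y hy z hz => ?_
      rw [dist_eq_norm, dist_eq_norm]
      rw [ha] at hy hz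
      exact hv.lipschitz t ht y hy z hz
    · have h1 : max (β - s) (s - α) ≤ β - α := max_le (by linarith [hs.1]) (by linarith [hs.2])
      have := mul_le_mul_of_nonneg_left h1 hv.B_nonneg
      have := hv.B_small
      rw [ha]
      show B' * max (β - s) (s - α) ≤ 2 * r - r
      linarith
  -- The fixed point of the Picard operator is used directly because it also carries the confinement
  -- to the ball.
  obtain ⟨y, hy⟩ := ODE.FunSpace.exists_isFixedPt_next hpl hb
  have hmem : ∀ {t}, y.compProj t ∈ Metric.closedBall x₀ (2 * r) := fun {t} =>
    ha ▸ y.compProj_mem_closedBall hpl.mul_max_le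
  refine ⟨y.compProj, ?_, fun t ht => ⟨hmem, ?_⟩⟩
  · have := ODE.FunSpace.compProj_val (α := y) (t := ⟨s, hs⟩)
    rw [this, ← hy, ODE.FunSpace.next_apply₀]
  · apply ODE.hasDerivWithinAt_picard_Icc hs hpl.continuousOn_uncurry
      y.continuous_compProj.continuousOn (fun _ _ => y.compProj_mem_closedBall hpl.mul_max_le) b ht |>.congr_of_mem _ ht
    intro t' ht'
    nth_rw 1 [← hy]
    rw [ODE.FunSpace.compProj_of_mem ht', ODE.FunSpace.next_apply]

theorem norm_sub_le (hv : IsSlowField v α β x₀ ρ B L) {y : ℝ → E}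
    (hy : IsSlowSol v α β x₀ (2 * ρ) y) {s t : ℝ} (hs : s ∈ Icc α β) (ht : t ∈ Icc α β) :
    ‖y t - y s‖ ≤ B * |t - s| :=
  (convex_Icc α β).norm_image_sub_le_of_norm_hasDerivWithin_le (fun τ hτ => (hy τ hτ).2)
    (fun τ hτ => hv.bound τ hτ _ (hy τ hτ).1) hs ht

theorem norm_sub_le_radius (hv : IsSlowField v α β x₀ ρ B L) {y : ℝ → E}
    (hy : IsSlowSol v α β x₀ (2 * ρ) y) {s t : ℝ} (hs : s ∈ Icc α β) (ht : t ∈ Icc α β) :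
    ‖y t - y s‖ ≤ ρ / 8 := by
  refine (hv.norm_sub_le hy hs ht).trans (le_trans ?_ hv.B_small)
  refine mul_le_mul_of_nonneg_left ?_ hv.B_nonneg
  rw [abs_le]; constructor <;> linarith [hs.1, hs.2, ht.1, ht.2]

/-- In place of Grönwall: the difference varies by at most `L (β - α) ≤ 1/2` times its maximal norm,
so that maximum is at most twice the norm at `s`. Inserting this into the variation gives the second
bound, which is small with `L`. -/
theorem dist_sol_le (hv : IsSlowField v α β x₀ ρ B L) {y z : ℝ → E}
    (hy : IsSlowSol v α β x₀ (2 * ρ) y) (hz : IsSlowSol v α β x₀ (2 * ρ) z) {s t : ℝ}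
    (hs : s ∈ Icc α β) (ht : t ∈ Icc α β) :
    ‖y t - z t‖ ≤ 2 * ‖y s - z s‖ ∧
    ‖(y t - z t) - (y s - z s)‖ ≤ 2 * L * (β - α) * ‖y s - z s‖ := by
  obtain ⟨m, hm, hmax⟩ := isCompact_Icc.exists_isMaxOn ⟨s, hs⟩
    (hy.continuousOn.sub hz.continuousOn).norm
  have hd : ∀ t ∈ Icc α β, ‖(y t - z t) - (y s - z s)‖ ≤ L * (β - α) * ‖y m - z m‖ := by
    intro t ht
    refine ((convex_Icc α β).norm_image_sub_le_of_norm_hasDerivWithin_le (f := fun τ => y τ - z τ)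
      (C := L * ‖y m - z m‖) (fun τ hτ => (hy τ hτ).2.sub (hz τ hτ).2) (fun τ hτ => ?_)
      hs ht).trans ?_
    · exact (hv.lipschitz τ hτ _ (hy τ hτ).1 _ (hz τ hτ).1).trans
        (mul_le_mul_of_nonneg_left (hmax hτ) hv.L_nonneg)
    · have : ‖t - s‖ ≤ β - α := by
        rw [Real.norm_eq_abs, abs_le]; constructor <;> linarith [hs.1, hs.2, ht.1, ht.2]
      calc L * ‖y m - z m‖ * ‖t - s‖ ≤ L * ‖y m - z m‖ * (β - α) :=
            mul_le_mul_of_nonneg_left this (mul_nonneg hv.L_nonneg (norm_nonneg _))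
        _ = _ := by ring
  have hm2 : ‖y m - z m‖ ≤ 2 * ‖y s - z s‖ := by
    have h1 := hd m hm
    have h2 := norm_sub_norm_le (y m - z m) (y s - z s)
    have h3 := mul_le_mul_of_nonneg_right hv.L_small (norm_nonneg (y m - z m))
    linarith
  refine ⟨(hmax ht).trans hm2, (hd t ht).trans ?_⟩
  have : 0 ≤ L * (β - α) := mul_nonneg hv.L_nonneg (by linarith [hv.le])
  calc _ ≤ L * (β - α) * (2 * ‖y s - z s‖) := mul_le_mul_of_nonneg_left hm2 this
    _ = _ := by ring

end IsSlowField

end ODE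

/-! ### Trajectories in a tube, parametrized by the phase. -/

namespace SingleModeSystem

variable {n : ℕ}

/-- The velocity `dx₂/dx₁` of the slow coordinates with respect to the phase. -/
noncomputable def slope (H : SingleModeSystem n) (ε σ : ℝ) (y : EuclideanSpace ℝ (Fin n)) :
    EuclideanSpace ℝ (Fin n) :=
  (ε / (1 + ε * H.F₁ ε (σ, y))) • H.F₂ ε (σ, y)

/-- A tube `[α, x₁ + h] × closedBall x₂ (2ρ)` in which the dynamics is a small perturbation of the
motion along the phase and which every trajectory leaves through a transverse guard. -/
structure IsTube (H : SingleModeSystem n) (ε α h ρ B L sg m C : ℝ) : Prop where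
  α_neg : α < 0
  h_pos : 0 < h
  h_le : h ≤ H.x₁
  isOpen_X : IsOpen H.X
  contDiffOn_F : ContDiffOn ℝ 1 (H.F ε) H.X
  subset : Icc α (H.x₁ + h) ×ˢ Metric.closedBall H.x₂ (2 * ρ) ⊆ H.X
  speed : ∀ x ∈ Icc α (H.x₁ + h) ×ˢ Metric.closedBall H.x₂ (2 * ρ), |ε * H.F₁ ε x| ≤ 1 / 2
  slow : IsSlowField (H.slope ε) α (H.x₁ + h) H.x₂ ρ B L
  neg : ∀ σ ∈ Icc α (H.x₁ - h / 3), ∀ y ∈ Metric.closedBall H.x₂ (2 * ρ),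
    sg * H.γ ε (σ, y) < 0
  pos : ∀ y ∈ Metric.closedBall H.x₂ (2 * ρ), 0 < sg * H.γ ε (H.x₁ + h / 3, y)
  m_pos : 0 < m
  deriv : ∀ σ ∈ Icc (H.x₁ - h / 3) (H.x₁ + h), ∀ y ∈ Metric.closedBall H.x₂ (2 * ρ),
    ∃ D : ℝ × EuclideanSpace ℝ (Fin n) →L[ℝ] ℝ, HasFDerivAt (H.γ ε) D (σ, y) ∧ m ≤ sg * D (1, H.slope ε σ y)
  C_nonneg : 0 ≤ C
  lipschitz : ∀ σ ∈ Icc (H.x₁ - h / 3) (H.x₁ + h), ∀ y ∈ Metric.closedBall H.x₂ (2 * ρ),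
    ∀ z ∈ Metric.closedBall H.x₂ (2 * ρ), |sg * H.γ ε (σ, y) - sg * H.γ ε (σ, z)| ≤ C * ‖y - z‖
  base : (H.x₁, H.x₂) ∈ H.guard ε

/-- `y` is the slow component, as a function of the phase, of a trajectory in the tube. -/
abbrev IsPhaseSol (H : SingleModeSystem n) (ε α h ρ : ℝ) (y : ℝ → EuclideanSpace ℝ (Fin n)) :
    Prop :=
  IsSlowSol (H.slope ε) α (H.x₁ + h) H.x₂ (2 * ρ) y

/-- The trajectory with slow component `y` crosses the guard at the phase `τ`, at a speed that is
at least `m`. -/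
structure IsHit (H : SingleModeSystem n) (ε α h sg m : ℝ)
    (y : ℝ → EuclideanSpace ℝ (Fin n)) (τ : ℝ) : Prop where
  mem : τ ∈ Ioo (H.x₁ - h / 3) (H.x₁ + h / 3)
  zero : sg * H.γ ε (τ, y τ) = 0
  neg : ∀ σ ∈ Ico α τ, sg * H.γ ε (σ, y σ) < 0
  pos : ∀ σ ∈ Ioc τ (H.x₁ + h), 0 < sg * H.γ ε (σ, y σ)
  rate : ∀ σ ∈ Icc (H.x₁ - h / 3) (H.x₁ + h), m * |σ - τ| ≤ |sg * H.γ ε (σ, y σ)|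

namespace IsTube

variable {H : SingleModeSystem n} {ε α h ρ B L sg m C : ℝ}

theorem sg_ne (hT : H.IsTube ε α h ρ B L sg m C) : sg ≠ 0 := by
  rintro rfl
  have := hT.pos H.x₂ (Metric.mem_closedBall_self (by linarith [hT.slow.ρ_pos]))
  simp at this

/-- The oriented guard function `sg * γ` is negative up to the phase `x₁ - h / 3`, positive at `x₁ +
h / 3`, and grows along the trajectory at rate at least `m` in the last stretch of the tube. This
gives one zero, the signs on both sides, and the linear lower bound. -/
theorem exists_hit (hT : H.IsTube ε α h ρ B L sg m C) {y : ℝ → EuclideanSpace ℝ (Fin n)}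
    (hy : H.IsPhaseSol ε α h ρ y) : ∃ τ, H.IsHit ε α h sg m y τ := by
  have hα := hT.α_neg
  have hh := hT.h_pos
  have hh' := hT.h_le
  have hm := hT.m_pos
  set κ := H.x₁ - h / 3 with hκ
  set β := H.x₁ + h with hβ
  have hsub : Icc κ β ⊆ Icc α β := Icc_subset_Icc_left (by linarith)
  set g : ℝ → ℝ := fun σ => sg * H.γ ε (σ, y σ) with hg
  have hd : ∀ σ ∈ Icc κ β, ∃ d, m ≤ d ∧ HasDerivWithinAt g d (Icc κ β) σ := by
    intro σ hσ
    obtain ⟨D, hD, hDm⟩ := hT.deriv σ hσ (y σ) (hy σ (hsub hσ)).1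
    refine ⟨_, hDm, ?_⟩
    have h1 : HasDerivWithinAt (fun σ => (σ, y σ)) (1, H.slope ε σ (y σ)) (Icc κ β) σ :=
      (hasDerivWithinAt_id _ _).prodMk ((hy σ (hsub hσ)).2.mono hsub)
    exact (HasFDerivAt.comp_hasDerivWithinAt σ hD h1).const_mul sg
  have hcont : ContinuousOn g (Icc κ β) := fun σ hσ => by
    obtain ⟨d, -, hd⟩ := hd σ hσ
    exact hd.continuousWithinAt
  have hmono : ∀ s ∈ Icc κ β, ∀ t ∈ Icc κ β, s ≤ t → m * (t - s) ≤ g t - g s := by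
    refine (convex_Icc κ β).mul_sub_le_image_sub_of_le_deriv hcont ?_ ?_
    · intro σ hσ
      obtain ⟨d, -, hd⟩ := hd σ (interior_subset hσ)
      exact (hd.differentiableWithinAt.mono interior_subset)
    · intro σ hσ
      obtain ⟨d, hmd, hd⟩ := hd σ (interior_subset hσ)
      rwa [(hd.hasDerivAt (mem_interior_iff_mem_nhds.1 hσ)).deriv]
  have hκm : κ ∈ Icc κ β := ⟨le_rfl, by linarith⟩
  have hβm : H.x₁ + h / 3 ∈ Icc κ β := ⟨by linarith, by linarith⟩
  have hκn : g κ < 0 := hT.neg κ ⟨by linarith, le_rfl⟩ _ (hy κ (hsub hκm)).1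
  have hβp : 0 < g (H.x₁ + h / 3) := hT.pos _ (hy _ (hsub hβm)).1
  obtain ⟨τ, hτ, hτ0⟩ : (0 : ℝ) ∈ g '' Icc κ (H.x₁ + h / 3) :=
    intermediate_value_Icc (by linarith) (hcont.mono (Icc_subset_Icc_right (by linarith)))
      ⟨hκn.le, hβp.le⟩
  have hτ1 : κ < τ := lt_of_le_of_ne hτ.1 fun h => by rw [h, hτ0] at hκn; exact lt_irrefl _ hκn
  have hτ2 : τ < H.x₁ + h / 3 :=
    lt_of_le_of_ne hτ.2 fun h => by rw [← h, hτ0] at hβp; exact lt_irrefl _ hβp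
  have hτm : τ ∈ Icc κ β := ⟨hτ.1, by linarith⟩
  refine ⟨τ, ⟨hτ1, hτ2⟩, hτ0, fun σ hσ => ?_, fun σ hσ => ?_, fun σ hσ => ?_⟩
  · rcases le_total σ κ with h1 | h1
    · exact hT.neg σ ⟨hσ.1, h1⟩ _ (hy σ ⟨hσ.1, by linarith⟩).1
    · have h2 := hmono σ ⟨h1, by linarith [hσ.2]⟩ τ hτm hσ.2.le
      have h3 : 0 < m * (τ - σ) := mul_pos hm (by linarith [hσ.2])
      show g σ < 0
      linarith
  · have h2 := hmono τ hτm σ ⟨by linarith [hσ.1], hσ.2⟩ hσ.1.le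
    have h3 : 0 < m * (σ - τ) := mul_pos hm (by linarith [hσ.1])
    show 0 < g σ
    linarith
  · show m * |σ - τ| ≤ |g σ|
    rcases le_total σ τ with h1 | h1
    · have h2 := hmono σ hσ τ hτm h1
      rw [abs_sub_comm, abs_of_nonneg (by linarith : 0 ≤ τ - σ)]
      linarith [neg_abs_le (g σ)]
    · have h2 := hmono τ hτm σ hσ h1
      rw [abs_of_nonneg (by linarith : 0 ≤ σ - τ)]
      linarith [le_abs_self (g σ)]

theorem mem_X (hT : H.IsTube ε α h ρ B L sg m C) {y : ℝ → EuclideanSpace ℝ (Fin n)}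
    (hy : H.IsPhaseSol ε α h ρ y) {σ : ℝ} (hσ : σ ∈ Icc α (H.x₁ + h)) : (σ, y σ) ∈ H.X :=
  hT.subset ⟨hσ, (hy σ hσ).1⟩

theorem hit_mem (hT : H.IsTube ε α h ρ B L sg m C) {y : ℝ → EuclideanSpace ℝ (Fin n)} {τ : ℝ}
    (hτ : H.IsHit ε α h sg m y τ) : τ ∈ Icc α (H.x₁ + h) := by
  have := hT.α_neg; have := hT.h_pos; have := hT.h_le
  exact ⟨by linarith [hτ.mem.1], by linarith [hτ.mem.2]⟩

theorem hit_pos (hT : H.IsTube ε α h ρ B L sg m C) {y : ℝ → EuclideanSpace ℝ (Fin n)} {τ : ℝ}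
    (hτ : H.IsHit ε α h sg m y τ) : h / 2 < τ := by
  have := hT.α_neg; have := hT.h_pos; have := hT.h_le
  linarith [hτ.mem.1]

theorem zero_mem (hT : H.IsTube ε α h ρ B L sg m C) : (0 : ℝ) ∈ Icc α (H.x₁ + h) := by
  have := hT.α_neg; have := hT.h_pos; have := hT.h_le
  constructor <;> linarith

theorem x₁_mem (hT : H.IsTube ε α h ρ B L sg m C) : H.x₁ ∈ Icc α (H.x₁ + h) := by
  have := hT.α_neg; have := hT.h_pos; have := hT.h_le
  constructor <;> linarith

theorem mem_guard_iff (hT : H.IsTube ε α h ρ B L sg m C) {y : ℝ → EuclideanSpace ℝ (Fin n)}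
    (hy : H.IsPhaseSol ε α h ρ y) {τ : ℝ} (hτ : H.IsHit ε α h sg m y τ) {σ : ℝ}
    (hσ : σ ∈ Icc α (H.x₁ + h)) : (σ, y σ) ∈ H.guard ε ↔ σ = τ := by
  constructor
  · rintro ⟨-, h0⟩
    rcases lt_trichotomy σ τ with h1 | h1 | h1
    · have := hτ.neg σ ⟨hσ.1, h1⟩
      rw [h0] at this; simp at this
    · exact h1
    · have := hτ.pos σ ⟨h1, hσ.2⟩
      rw [h0] at this; simp at this
  · rintro rfl
    exact ⟨hT.mem_X hy hσ, (mul_eq_zero.1 hτ.zero).resolve_left hT.sg_ne⟩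

/-- The parametrization by time of a trajectory that is given as a function of the phase. -/
theorem exists_time (hT : H.IsTube ε α h ρ B L sg m C) {y : ℝ → EuclideanSpace ℝ (Fin n)}
    (hy : H.IsPhaseSol ε α h ρ y) (s₀ : ℝ) :
    ∃ σ : ℝ → ℝ, σ 0 = s₀ ∧ Continuous σ ∧
      (∀ s t, s ≤ t → 1 / 2 * (t - s) ≤ σ t - σ s ∧ σ t - σ s ≤ 3 / 2 * (t - s)) ∧
      ∀ a b, (∀ t ∈ Icc a b, σ t ∈ Icc α (H.x₁ + h)) → ∀ t ∈ Icc a b,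
        (σ t, y (σ t)) ∈ H.X ∧ HasDerivWithinAt (fun t => (σ t, y (σ t)))
          (H.F ε (σ t, y (σ t))) (Icc a b) t := by
  have hle : α ≤ H.x₁ + h := hT.slow.le
  -- The phase solves the autonomous scalar equation `σ' = f(σ)`. Outside the tube `f` is continued
  -- by its end values; this gives a global curve, which is a trajectory of the system as long as
  -- the phase stays in the tube.
  set f : Icc α (H.x₁ + h) → ℝ := fun σ => 1 + ε * H.F₁ ε (σ, y σ) with hf
  have hfc : Continuous f := by
    have h1 : ContinuousOn (fun x => (H.F ε x).1) H.X := hT.contDiffOn_F.continuousOn.fst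
    have h2 : ContinuousOn (fun σ => (H.F ε (σ, y σ)).1) (Icc α (H.x₁ + h)) :=
      h1.comp (continuousOn_id.prodMk hy.continuousOn) fun σ hσ => hT.mem_X hy hσ
    exact h2.domRestrict
  have hfb : ∀ x, 1 / 2 ≤ f x ∧ f x ≤ 3 / 2 := fun x => by
    have := abs_le.1 (hT.speed (x, y x) ⟨x.2, (hy x x.2).1⟩)
    constructor <;> simp only [hf] <;> linarith [this.1, this.2]
  obtain ⟨σ, hσ0, hσ⟩ := exists_scalar_integralCurve (h := IccExtend hle f) hfc.Icc_extend'
    (fun x => (hfb _).1) (fun x => (hfb _).2) s₀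
  have hdiff : Differentiable ℝ σ := fun t => (hσ t).differentiableAt
  refine ⟨σ, hσ0, hdiff.continuous, fun s t hst => ⟨?_, ?_⟩, fun a b hab t ht => ?_⟩
  · exact mul_sub_le_image_sub_of_le_deriv hdiff (fun x => by rw [(hσ x).deriv]; exact (hfb _).1) hst
  · exact image_sub_le_mul_sub_of_deriv_le hdiff (fun x => by rw [(hσ x).deriv]; exact (hfb _).2) hst
  · have hm := hab t ht
    refine ⟨hT.mem_X hy hm, ?_⟩
    have h1 := hσ t
    rw [IccExtend_of_mem _ _ hm] at h1
    have h2 : HasDerivWithinAt (fun t => y (σ t)) (f ⟨σ t, hm⟩ • H.slope ε (σ t) (y (σ t)))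
        (Icc a b) t := (hy _ hm).2.scomp t h1.hasDerivWithinAt fun u hu => hab u hu
    have h3 : f ⟨σ t, hm⟩ • H.slope ε (σ t) (y (σ t)) = ε • H.F₂ ε (σ t, y (σ t)) := by
      have hne : (1 + ε * H.F₁ ε (σ t, y (σ t))) ≠ 0 := by
        have := (hfb ⟨σ t, hm⟩).1
        simp only [hf] at this
        intro h0
        rw [h0] at this
        norm_num at this
      simp only [hf, slope, smul_smul]
      congr 1
      field_simp
    rw [h3] at h2
    exact h1.hasDerivWithinAt.prodMk h2

/-- The arc that starts on a given trajectory before the guard. -/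
theorem exists_arc (hT : H.IsTube ε α h ρ B L sg m C) {y : ℝ → EuclideanSpace ℝ (Fin n)}
    (hy : H.IsPhaseSol ε α h ρ y) {τ : ℝ} (hτ : H.IsHit ε α h sg m y τ) {s₀ : ℝ}
    (hs : s₀ ∈ Icc α τ) :
    ∃ (T : ℝ) (σ : ℝ → ℝ), σ 0 = s₀ ∧ σ T = τ ∧ 2 / 3 * (τ - s₀) ≤ T ∧ T ≤ 2 * (τ - s₀) ∧
      (∀ s ∈ Icc 0 T, σ s ∈ Icc s₀ τ) ∧ Icc s₀ τ ⊆ σ '' Icc 0 T ∧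
      H.IsArc ε T (fun t => (σ t, y (σ t))) ∧
      ∀ T' c, H.IsArc ε T' c → c 0 = (s₀, y s₀) → T' = T ∧
        ∀ s ∈ Icc 0 T, c s = (σ s, y (σ s)) := by
  obtain ⟨σ, hσ0, hσc, hσ, hcurve⟩ := hT.exists_time hy s₀
  have hτm := hT.hit_mem hτ
  have hmono : StrictMono σ := fun s t hst => by linarith [(hσ s t hst.le).1]
  -- The phase speed is at least `1/2`, so `τ` is reached by the time `2 (τ - s₀)`.
  obtain ⟨T, hTm, hTτ⟩ : τ ∈ σ '' Icc 0 (2 * (τ - s₀)) := by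
    refine intermediate_value_Icc (by linarith [hs.2]) hσc.continuousOn ⟨by rw [hσ0]; exact hs.2, ?_⟩
    have := (hσ 0 (2 * (τ - s₀)) (by linarith [hs.2])).1
    linarith
  have hTl := (hσ 0 T hTm.1).2
  have hrange : ∀ s ∈ Icc 0 T, σ s ∈ Icc s₀ τ := fun s hs' => by
    rw [← hσ0, ← hTτ]
    exact ⟨hmono.monotone hs'.1, hmono.monotone hs'.2⟩
  have hrange' : ∀ s ∈ Icc 0 T, σ s ∈ Icc α (H.x₁ + h) := fun s hs' =>
    ⟨hs.1.trans (hrange s hs').1, (hrange s hs').2.trans hτm.2⟩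
  have hguard : ∀ s ∈ Icc 0 T, (σ s, y (σ s)) ∈ H.guard ε ↔ s = T := fun s hs' => by
    rw [hT.mem_guard_iff hy hτ (hrange' s hs'), ← hTτ, hmono.injective.eq_iff]
  refine ⟨T, σ, hσ0, hTτ, by linarith, hTm.2, hrange, ?_, ?_, ?_⟩
  · rw [← hσ0, ← hTτ]
    exact intermediate_value_Icc hTm.1 hσc.continuousOn
  · exact ⟨hTm.1, fun s hs' => (hcurve 0 T hrange' s hs').1,
      fun s hs' => (hcurve 0 T hrange' s hs').2,
      fun s hs' => fun hg => hs'.2.ne ((hguard s (Ico_subset_Icc_self hs')).1 hg),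
      (hguard T ⟨hTm.1, le_rfl⟩).2 rfl⟩
  · intro T' c hc hc0
    -- Any other arc agrees with this one as long as both run. If one stopped earlier, the other
    -- would meet the guard before its own end.
    have key : ∀ S, S ≤ T → S ≤ T' → ∀ s ∈ Icc 0 S, c s = (σ s, y (σ s)) := by
      intro S hS hS'
      refine integralCurve_eqOn hT.isOpen_X hT.contDiffOn_F (fun t ht => ?_) (fun t ht => ?_)
        (Or.inl ?_)
      · have ht' : t ∈ Icc 0 T' := ⟨ht.1, ht.2.trans hS'⟩
        exact ⟨hc.mem t ht', (hc.hasDeriv t ht').mono (Icc_subset_Icc_right hS')⟩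
      · exact hcurve 0 S (fun t ht => hrange' t ⟨ht.1, ht.2.trans hS⟩) t ht
      · rw [hc0, hσ0]
    have hTT : T' = T := by
      rcases lt_trichotomy T' T with h1 | h1 | h1
      · have h2 := hc.mem_guard
        rw [key T' h1.le le_rfl T' ⟨hc.nonneg, le_rfl⟩, hguard T' ⟨hc.nonneg, h1.le⟩] at h2
        exact h2
      · exact h1
      · refine absurd ?_ (hc.not_mem_guard T ⟨hTm.1, h1⟩)
        rw [key T le_rfl h1.le T ⟨hTm.1, le_rfl⟩]
        exact (hguard T ⟨hTm.1, le_rfl⟩).2 rfl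
    exact ⟨hTT, key T le_rfl hTT.ge⟩

/-- The slow reset map is the reset at the point where the trajectory crosses the guard. -/
theorem slowReset_eq (hT : H.IsTube ε α h ρ B L sg m C) {y : ℝ → EuclideanSpace ℝ (Fin n)}
    (hy : H.IsPhaseSol ε α h ρ y) {τ : ℝ} (hτ : H.IsHit ε α h sg m y τ) :
    H.slowReset ε (y H.x₁) = (H.R ε (τ, y τ)).2 := by
  have hα := hT.α_neg
  have hh := hT.h_pos
  have hh' := hT.h_le
  obtain ⟨σ, hσ0, hσc, hσ, hcurve⟩ := hT.exists_time hy H.x₁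
  have hmono : StrictMono σ := fun s t hst => by linarith [(hσ s t hst.le).1]
  have hup : ∀ s, |σ s - H.x₁| ≤ 3 / 2 * |s| := fun s => by
    rcases le_total 0 s with h1 | h1
    · have := hσ 0 s h1
      rw [abs_of_nonneg h1, abs_le]; constructor <;> linarith [this.1, this.2]
    · have := hσ s 0 h1
      rw [abs_of_nonpos h1, abs_le]; constructor <;> linarith [this.1, this.2]
  have hlow : ∀ s, 1 / 2 * |s| ≤ |σ s - H.x₁| := fun s => by
    rcases le_total 0 s with h1 | h1
    · have := hσ 0 s h1
      rw [abs_of_nonneg h1]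
      exact le_trans (by linarith [this.1]) (le_abs_self _)
    · have := hσ s 0 h1
      rw [abs_of_nonpos h1]
      exact le_trans (by linarith [this.1]) (neg_le_abs _)
  -- The crossing may lie before or after the phase `x₁`, so `t` has either sign.
  obtain ⟨t, -, ht⟩ : τ ∈ σ '' Icc (-h) h := by
    have h1 := (hσ 0 h hh.le).1
    have h2 := (hσ (-h) 0 (by linarith)).1
    exact intermediate_value_Icc (by linarith) hσc.continuousOn
      ⟨by linarith [hτ.mem.1], by linarith [hτ.mem.2]⟩
  -- With phase speed at most `3/2`, times up to `2h/3` keep the phase within `h` of `x₁`, hence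
  -- inside the tube, where the flow is known.
  have htb : |t| ≤ 2 / 3 * h := by
    have h1 := hlow t
    have h2 : |σ t - H.x₁| ≤ h / 3 := by
      rw [ht, abs_le]; constructor <;> linarith [hτ.mem.1, hτ.mem.2]
    linarith
  have hJ : ∀ s, |s| ≤ |t| → σ s ∈ Icc α (H.x₁ + h) := fun s hs => by
    have h1 := abs_le.1 (hup s)
    constructor <;> linarith [h1.1, h1.2]
  have hJ' : ∀ s, |s| ≤ |t| → ∀ u ∈ uIcc 0 s, σ u ∈ Icc α (H.x₁ + h) := fun s hs u hu => by
    refine hJ u (le_trans ?_ hs)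
    simpa using abs_sub_left_of_mem_uIcc hu
  have hflow : ∀ s, |s| ≤ |t| → ∀ z, H.FlowsTo ε s (H.x₁, y H.x₁) z ↔ z = (σ s, y (σ s)) := by
    intro s hs z
    constructor
    · rintro ⟨c, hc0, hcs, hc⟩
      have h0 : c 0 = (σ 0, y (σ 0)) := by rw [hc0, hσ0]
      have heq : EqOn c (fun s => (σ s, y (σ s))) (uIcc 0 s) := by
        rw [uIcc] at hc ⊢
        refine integralCurve_eqOn hT.isOpen_X hT.contDiffOn_F hc
          (hcurve _ _ (hJ' s hs)) ?_
        rcases le_total 0 s with h1 | h1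
        · left
          rwa [inf_of_le_left h1]
        · right
          rwa [sup_of_le_left h1]
      rw [← hcs, heq right_mem_uIcc]
    · rintro rfl
      exact ⟨fun s => (σ s, y (σ s)), by simp only [hσ0], rfl, hcurve _ _ (hJ' s hs)⟩
  have hguard : ∀ s, |s| ≤ |t| → (∃ z ∈ H.guard ε, H.FlowsTo ε s (H.x₁, y H.x₁) z) → s = t := by
    rintro s hs ⟨z, hz, hzs⟩
    rw [hflow s hs] at hzs
    rw [hzs, hT.mem_guard_iff hy hτ (hJ s hs), ← ht] at hz
    exact hmono.injective hz
  -- `t` is the only guard time of absolute value at most `|t|`, so the choices made in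
  -- `timeToGuard` and `flow` have no freedom.
  have hP : (∃ z ∈ H.guard ε, H.FlowsTo ε t (H.x₁, y H.x₁) z) ∧
      ∀ s : ℝ, (∃ z ∈ H.guard ε, H.FlowsTo ε s (H.x₁, y H.x₁) z) → |t| ≤ |s| := by
    refine ⟨⟨(σ t, y (σ t)), ?_, (hflow t le_rfl _).2 rfl⟩, fun s hs => ?_⟩
    · rw [hT.mem_guard_iff hy hτ (hJ t le_rfl), ht]
    · by_contra! hlt
      exact hlt.ne (by rw [hguard s hlt.le hs])
  have htime : H.timeToGuard ε (H.x₁, y H.x₁) = t := by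
    have := Classical.epsilon_spec (⟨t, hP⟩ : ∃ t : ℝ,
      (∃ z ∈ H.guard ε, H.FlowsTo ε t (H.x₁, y H.x₁) z) ∧
      ∀ s : ℝ, (∃ z ∈ H.guard ε, H.FlowsTo ε s (H.x₁, y H.x₁) z) → |t| ≤ |s|)
    exact hguard _ (this.2 t hP.1) this.1
  have hfl : H.flow ε t (H.x₁, y H.x₁) = (τ, y τ) := by
    have := Classical.epsilon_spec (⟨_, (hflow t le_rfl _).2 rfl⟩ : ∃ z, H.FlowsTo ε t (H.x₁, y H.x₁) z)
    rw [hflow t le_rfl] at this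
    rw [← ht]
    exact this
  rw [slowReset, htime, hfl]

/-- The phases at which two trajectories cross the guard. -/
theorem hit_sub_le (hT : H.IsTube ε α h ρ B L sg m C) {y z : ℝ → EuclideanSpace ℝ (Fin n)}
    (hy : H.IsPhaseSol ε α h ρ y) (hz : H.IsPhaseSol ε α h ρ z) {τ τ' : ℝ}
    (hτ : H.IsHit ε α h sg m y τ) (hτ' : H.IsHit ε α h sg m z τ') :
    |τ' - τ| ≤ 2 * C / m * ‖y 0 - z 0‖ := by
  have hh := hT.h_pos
  -- At the phase `τ'` the trajectory `z` is on the guard, while the guard function along `y` is at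
  -- least `m |τ' - τ|` in size; the Lipschitz bound compares the two.
  have h1 := hτ.rate τ' ⟨hτ'.mem.1.le, by linarith [hτ'.mem.2]⟩
  have h2 := hT.lipschitz τ' ⟨hτ'.mem.1.le, by linarith [hτ'.mem.2]⟩ _
    (hy τ' (hT.hit_mem hτ')).1 _ (hz τ' (hT.hit_mem hτ')).1
  rw [hτ'.zero, sub_zero] at h2
  have h3 := mul_le_mul_of_nonneg_left
    (hT.slow.dist_sol_le hy hz hT.zero_mem (hT.hit_mem hτ')).1 hT.C_nonneg
  rw [div_mul_eq_mul_div, le_div_iff₀ hT.m_pos]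
  linarith

end IsTube

end SingleModeSystem

/-! ### From a contracting return map to a stable periodic orbit. -/

/-- The contraction principle on a closed ball. -/
theorem exists_fixedPoint_of_contracting {E : Type*} [NormedAddCommGroup E] [CompleteSpace E]
    {P : E → E} {x₀ : E} {r q : ℝ} (hr : 0 ≤ r) (hq0 : 0 ≤ q) (hq1 : q < 1)
    (hP : ∀ a ∈ Metric.closedBall x₀ r, ∀ b ∈ Metric.closedBall x₀ r,
      ‖P a - P b‖ ≤ q * ‖a - b‖)
    (h0 : ‖P x₀ - x₀‖ ≤ (1 - q) * r) : ∃ p ∈ Metric.closedBall x₀ r, P p = p := by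
  have hx₀ : x₀ ∈ Metric.closedBall x₀ r := Metric.mem_closedBall_self hr
  have hmaps : MapsTo P (Metric.closedBall x₀ r) (Metric.closedBall x₀ r) := fun a ha => by
    have h1 := hP a ha x₀ hx₀
    have h2 : ‖a - x₀‖ ≤ r := mem_closedBall_iff_norm.1 ha
    have h3 := mul_le_mul_of_nonneg_left h2 hq0
    rw [mem_closedBall_iff_norm]
    calc ‖P a - x₀‖ = ‖(P a - P x₀) + (P x₀ - x₀)‖ := by congr 1; abel
      _ ≤ ‖P a - P x₀‖ + ‖P x₀ - x₀‖ := norm_add_le _ _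
      _ ≤ r := by linarith
  have hc : ContractingWith (⟨q, hq0⟩ : NNReal) (hmaps.restrict P _ _) := by
    refine ⟨hq1, LipschitzWith.of_dist_le_mul fun a b => ?_⟩
    rw [Subtype.dist_eq, Subtype.dist_eq, dist_eq_norm, dist_eq_norm]
    exact hP a a.2 b b.2
  obtain ⟨p, hp, hpf, -⟩ := hc.exists_fixedPoint' Metric.isClosed_closedBall.isComplete hmaps hx₀
    (edist_ne_top _ _)
  exact ⟨p, hp, hpf⟩

namespace SingleModeSystem

variable {n : ℕ}

/-- An execution exists if each state of a set has an arc whose reset is again in the set. -/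
theorem exists_execution {H : SingleModeSystem n} {ε t₀ : ℝ} (ht₀ : 0 < t₀)
    {S : Set (ℝ × EuclideanSpace ℝ (Fin n))}
    (hS : ∀ x ∈ S, ∃ T c, H.IsArc ε T c ∧ c 0 = x ∧ H.R ε (c T) ∈ S ∧ (x.1 = 0 → t₀ ≤ T))
    (hR : ∀ x ∈ H.guard ε, (H.R ε x).1 = 0) {x : ℝ × EuclideanSpace ℝ (Fin n)} (hx : x ∈ S) :
    ∃ T c, H.IsExecution ε x T c ∧
      Tendsto (fun k => ∑ j ∈ Finset.range k, T j) atTop atTop := by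
  choose T c harc hc0 hmem hT using hS
  let u : ℕ → S := fun k => Nat.rec ⟨x, hx⟩ (fun _ z => ⟨_, hmem z.1 z.2⟩) k
  have hu : ∀ k, (u (k + 1)).1 = H.R ε (c _ (u k).2 (T _ (u k).2)) := fun k => rfl
  have hu1 : ∀ k, (u (k + 1)).1.1 = 0 := fun k => by
    rw [hu]; exact hR _ (harc _ _).mem_guard
  refine ⟨fun k => T _ (u k).2, fun k => c _ (u k).2, ⟨hc0 _ _, fun k => harc _ _, fun k => ?_⟩, ?_⟩
  · rw [hc0, hu]
  · have hlow : ∀ k : ℕ, ((k : ℝ) - 1) * t₀ ≤ ∑ j ∈ Finset.range k, T _ (u j).2 := by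
      intro k
      induction k with
      | zero => simp [ht₀.le]
      | succ k ih =>
        rw [Finset.sum_range_succ]
        rcases k with _ | k
        · have := (harc _ (u 0).2).nonneg
          simpa using this
        · have := hT _ (u (k + 1)).2 (hu1 k)
          push_cast at ih ⊢
          linarith
    refine tendsto_atTop_mono hlow ?_
    exact (tendsto_atTop_add_const_right _ _ tendsto_natCast_atTop_atTop).atTop_mul_const ht₀

namespace IsTube

variable {H : SingleModeSystem n} {ε α h ρ B L sg m C q : ℝ}

/-- A contracting slow reset map has a trajectory that returns to its start. -/
theorem exists_closed_sol (hT : H.IsTube ε α h ρ B L sg m C) (hq0 : 0 < q) (hq1 : q < 1)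
    (hcontr : ∀ y z, H.IsPhaseSol ε α h ρ y → H.IsPhaseSol ε α h ρ z →
      y 0 ∈ Metric.closedBall H.x₂ ρ → z 0 ∈ Metric.closedBall H.x₂ ρ →
      ‖H.slowReset ε (y H.x₁) - H.slowReset ε (z H.x₁)‖ ≤ q * ‖y 0 - z 0‖)
    (hself : ∀ y, H.IsPhaseSol ε α h ρ y → y 0 = H.x₂ →
      ‖H.slowReset ε (y H.x₁) - H.x₂‖ ≤ (1 - q) * (ρ / 2)) :
    ∃ y, H.IsPhaseSol ε α h ρ y ∧ y 0 ∈ Metric.closedBall H.x₂ (ρ / 2) ∧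
      H.slowReset ε (y H.x₁) = y 0 := by
  have hρ := hT.slow.ρ_pos
  -- The solution is made a total function of its start, with a junk value outside the ball, so that
  -- the return map is defined everywhere.
  have hex : ∀ a : EuclideanSpace ℝ (Fin n), ∃ y, a ∈ Metric.closedBall H.x₂ ρ →
      y 0 = a ∧ H.IsPhaseSol ε α h ρ y := fun a => by
    by_cases ha : a ∈ Metric.closedBall H.x₂ ρ
    · obtain ⟨y, hy⟩ := hT.slow.exists_sol hT.zero_mem ha
      exact ⟨y, fun _ => hy⟩
    · exact ⟨fun _ => 0, fun h => absurd h ha⟩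
  choose Y hY using hex
  have hsub : Metric.closedBall H.x₂ (ρ / 2) ⊆ Metric.closedBall H.x₂ ρ :=
    Metric.closedBall_subset_closedBall (by linarith)
  have hx₂ : H.x₂ ∈ Metric.closedBall H.x₂ ρ := Metric.mem_closedBall_self hρ.le
  obtain ⟨p, hp, hpf⟩ := exists_fixedPoint_of_contracting (P := fun a => H.slowReset ε (Y a H.x₁))
    (x₀ := H.x₂) (r := ρ / 2) (by linarith) hq0.le hq1
    (fun a ha b hb => by
      have := hcontr _ _ (hY a (hsub ha)).2 (hY b (hsub hb)).2
        (by rw [(hY a (hsub ha)).1]; exact hsub ha) (by rw [(hY b (hsub hb)).1]; exact hsub hb)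
      rwa [(hY a (hsub ha)).1, (hY b (hsub hb)).1] at this)
    (hself _ (hY _ hx₂).2 (hY _ hx₂).1)
  have := hY p (hsub hp)
  exact ⟨Y p, this.2, by rw [this.1]; exact hp, by rw [this.1]; exact hpf⟩

/-- The reset has phase `0` and slow component `R̄ (y x₁) = y 0`, so it closes the arc. -/
theorem isPeriodicOrbit (hT : H.IsTube ε α h ρ B L sg m C)
    (hR : ∀ x ∈ H.guard ε, (H.R ε x).1 = 0) {y : ℝ → EuclideanSpace ℝ (Fin n)}
    (hy : H.IsPhaseSol ε α h ρ y) (hper : H.slowReset ε (y H.x₁) = y 0) {τ : ℝ}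
    (hτ : H.IsHit ε α h sg m y τ) :
    H.IsPeriodicOrbit ε ((fun σ => (σ, y σ)) '' Icc 0 τ) := by
  have hτ0 := hT.hit_pos hτ
  have hh := hT.h_pos
  obtain ⟨T, σ, hσ0, hσT, hTl, -, hr, hs, harc, -⟩ := hT.exists_arc hy hτ (s₀ := 0)
    ⟨hT.α_neg.le, by linarith⟩
  refine ⟨T, _, by linarith, harc, ?_, ?_⟩
  · simp only [hσ0, hσT]
    have hg := harc.mem_guard
    simp only [hσT] at hg
    exact Prod.ext (hR _ hg) (by rw [← hT.slowReset_eq hy hτ, hper])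
  · ext x
    constructor
    · rintro ⟨ς, hς, rfl⟩
      obtain ⟨s, hs, rfl⟩ := hs hς
      exact ⟨s, hs, rfl⟩
    · rintro ⟨s, hs, rfl⟩
      exact ⟨σ s, hr s hs, rfl⟩

/-- The distance of a trajectory to the orbit of another one. -/
theorem infDist_le (hT : H.IsTube ε α h ρ B L sg m C) {y z : ℝ → EuclideanSpace ℝ (Fin n)}
    (hy : H.IsPhaseSol ε α h ρ y) (hz : H.IsPhaseSol ε α h ρ z) {τ τ' : ℝ}
    (hτ : H.IsHit ε α h sg m y τ) (hτ' : H.IsHit ε α h sg m z τ') {b K : ℝ} (hb : 0 ≤ b)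
    (hyz : ‖z 0 - y 0‖ ≤ K * b) {s : ℝ} (hs : s ∈ Icc α τ') (hsb : -s ≤ b) :
    Metric.infDist (s, z s) ((fun σ => (σ, y σ)) '' Icc 0 τ) ≤
      ((1 + B) * (1 + 2 * C / m * K) + 2 * K) * b := by
  have hh := hT.h_pos
  have hτ0 : 0 < τ := by linarith [hT.hit_pos hτ]
  have hB := hT.slow.B_nonneg
  have hCm : 0 ≤ 2 * C / m := div_nonneg (by linarith [hT.C_nonneg]) hT.m_pos.le
  have hττ := hT.hit_sub_le hy hz hτ hτ'
  rw [norm_sub_rev] at hττ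
  have hττ' : |τ' - τ| ≤ 2 * C / m * K * b :=
    hττ.trans (by rw [mul_assoc]; exact mul_le_mul_of_nonneg_left hyz hCm)
  have hCKb : 0 ≤ 2 * C / m * K * b := (abs_nonneg _).trans hττ'
  have hsm : s ∈ Icc α (H.x₁ + h) := ⟨hs.1, hs.2.trans (hT.hit_mem hτ').2⟩
  -- `s'` is `s` clamped to the phases `[0, τ]` of the orbit. The overshoot is at most `b` below
  -- `0`, and at most the difference of the crossing phases above `τ`.
  obtain ⟨s', hs', hss⟩ : ∃ s' ∈ Icc 0 τ, |s - s'| ≤ b + 2 * C / m * K * b := by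
    rcases le_total s 0 with h1 | h1
    · refine ⟨0, ⟨le_rfl, hτ0.le⟩, ?_⟩
      rw [sub_zero, abs_of_nonpos h1]
      linarith
    · rcases le_total s τ with h2 | h2
      · exact ⟨s, ⟨h1, h2⟩, by rw [sub_self, abs_zero]; linarith⟩
      · refine ⟨τ, ⟨hτ0.le, le_rfl⟩, ?_⟩
        rw [abs_of_nonneg (by linarith)]
        linarith [le_abs_self (τ' - τ), hs.2]
  have hsm' : s' ∈ Icc α (H.x₁ + h) := ⟨hT.α_neg.le.trans hs'.1, hs'.2.trans (hT.hit_mem hτ).2⟩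
  have h1 : ‖z s - y s‖ ≤ 2 * (K * b) := by
    have := (hT.slow.dist_sol_le hz hy hT.zero_mem hsm).1
    linarith
  have h2 : ‖y s - y s'‖ ≤ B * (b + 2 * C / m * K * b) :=
    (hT.slow.norm_sub_le hy hsm' hsm).trans (mul_le_mul_of_nonneg_left hss hB)
  have h3 : ‖z s - y s'‖ ≤ ‖z s - y s‖ + ‖y s - y s'‖ := norm_sub_le_norm_sub_add_norm_sub _ _ _
  refine (Metric.infDist_le_dist_of_mem (mem_image_of_mem _ hs')).trans ?_
  rw [Prod.dist_eq]
  refine max_le ?_ ?_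
  · rw [Real.dist_eq]
    have : 0 ≤ B * (b + 2 * C / m * K * b) := mul_nonneg hB (by linarith)
    have : 0 ≤ K * b := (norm_nonneg _).trans hyz
    have e : ((1 + B) * (1 + 2 * C / m * K) + 2 * K) * b =
      (b + 2 * C / m * K * b) + B * (b + 2 * C / m * K * b) + 2 * (K * b) := by ring
    linarith
  · rw [dist_eq_norm]
    have e : ((1 + B) * (1 + 2 * C / m * K) + 2 * K) * b =
      (b + 2 * C / m * K * b) + B * (b + 2 * C / m * K * b) + 2 * (K * b) := by ring
    simp only
    linarith

/-- A contracting slow reset map gives an exponentially stable periodic orbit. -/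
theorem exists_stable (hT : H.IsTube ε α h ρ B L sg m C)
    (hR : ∀ x ∈ H.guard ε, (H.R ε x).1 = 0) (hq0 : 0 < q) (hq1 : q < 1)
    (hcontr : ∀ y z, H.IsPhaseSol ε α h ρ y → H.IsPhaseSol ε α h ρ z →
      y 0 ∈ Metric.closedBall H.x₂ ρ → z 0 ∈ Metric.closedBall H.x₂ ρ →
      ‖H.slowReset ε (y H.x₁) - H.slowReset ε (z H.x₁)‖ ≤ q * ‖y 0 - z 0‖)
    (hself : ∀ y, H.IsPhaseSol ε α h ρ y → y 0 = H.x₂ →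
      ‖H.slowReset ε (y H.x₁) - H.x₂‖ ≤ (1 - q) * (ρ / 2)) :
    ∃ Γ, H.IsPeriodicOrbit ε Γ ∧ H.IsExponentiallyStable ε Γ := by
  obtain ⟨y, hy, hy0, hper⟩ := hT.exists_closed_sol hq0 hq1 hcontr hself
  obtain ⟨τ, hτ⟩ := hT.exists_hit hy
  have hρ := hT.slow.ρ_pos
  have hB := hT.slow.B_nonneg
  have hα := hT.α_neg
  have hh := hT.h_pos
  have hhx := hT.h_le
  have hτ0 := hT.hit_pos hτ
  have hτm := hT.hit_mem hτ
  have hy0' := mem_closedBall_iff_norm.1 hy0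
  set Γ := (fun σ => (σ, y σ)) '' Icc 0 τ with hΓ
  -- If the nearest orbit point is at distance `d` from `x`, then the orbit at the phase of `x` has
  -- slow distance at most `(1 + B) d` from `x`; transport to the phase `0` costs a factor `2`.
  set K : ℝ := 2 * (1 + B) with hK
  have hKpos : 0 < K := by positivity
  set K₂ : ℝ := (1 + B) * (1 + 2 * C / m * K) + 2 * K with hK₂
  have hCm : 0 ≤ 2 * C / m := div_nonneg (by linarith [hT.C_nonneg]) hT.m_pos.le
  have hK₂pos : 0 < K₂ := by positivity
  -- With `K b₀ = ρ / 2`, and the orbit starting within `ρ / 2` of `x₂`, all starts considered stay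
  -- in the ball of radius `ρ` where the return map contracts.
  set b₀ : ℝ := ρ / (2 * K) with hb₀
  have hb₀pos : 0 < b₀ := by positivity
  have hKb₀ : K * b₀ = ρ / 2 := by rw [hb₀]; field_simp
  -- the states on trajectories close to the orbit
  set N : ℝ → ℝ × EuclideanSpace ℝ (Fin n) → Prop := fun b x =>
    0 ≤ b ∧ b ≤ b₀ ∧ ∃ z τ', H.IsPhaseSol ε α h ρ z ∧ H.IsHit ε α h sg m z τ' ∧ x.1 ∈ Icc α τ' ∧
      z x.1 = x.2 ∧ ‖z 0 - y 0‖ ≤ K * b ∧ -x.1 ≤ b with hN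
  have harc : ∀ b x, N b x → ∃ T c, H.IsArc ε T c ∧ c 0 = x ∧ (x.1 = 0 → h / 3 ≤ T) := by
    rintro b x ⟨hb, hbb, z, τ', hz, hτ', hx, hzx, hzy, hxb⟩
    obtain ⟨T, σ, hσ0, -, hTl, -, -, -, hA, -⟩ := hT.exists_arc hz hτ' hx
    refine ⟨T, _, hA, ?_, fun h0 => ?_⟩
    · simp only [hσ0, hzx]
    · have := hT.hit_pos hτ'
      linarith
  -- It is the parameter `b`, bounding the slow deviation at phase `0`, that shrinks by `q` at each
  -- reset; the distance to the orbit need not decrease monotonically and is only dominated by `K₂ *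
  -- b`.
  have hstep : ∀ b x, N b x → ∀ T c, H.IsArc ε T c → c 0 = x →
      N (q * b) (H.R ε (c T)) ∧ T ≤ 2 * (H.x₁ + h - α) ∧
      ∀ s ∈ Icc 0 T, Metric.infDist (c s) Γ ≤ K₂ * b := by
    rintro b x ⟨hb, hbb, z, τ', hz, hτ', hx, hzx, hzy, hxb⟩ T c hc hc0
    obtain ⟨T', σ, hσ0, hσT, -, hTu, hr, -, hA, huniq⟩ := hT.exists_arc hz hτ' hx
    obtain ⟨rfl, hcs⟩ := huniq T c hc (by rw [hc0, hzx])
    have hτm' := hT.hit_mem hτ'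
    have hzball : z 0 ∈ Metric.closedBall H.x₂ ρ := by
      rw [mem_closedBall_iff_norm]
      have h1 := mul_le_mul_of_nonneg_left hbb hKpos.le
      have h2 := norm_sub_le_norm_sub_add_norm_sub (z 0) (y 0) H.x₂
      linarith
    refine ⟨⟨by positivity, ?_, ?_⟩, ?_, ?_⟩
    · nlinarith
    · have hcT : c T = (τ', z τ') := by rw [hcs T ⟨hc.nonneg, le_rfl⟩, hσT]
      have hg : (τ', z τ') ∈ H.guard ε := hcT ▸ hc.mem_guard
      have hsr := hT.slowReset_eq hz hτ'
      have hd := hcontr z y hz hy hzball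
        (Metric.closedBall_subset_closedBall (by linarith) hy0)
      rw [hper] at hd
      have hd' : ‖H.slowReset ε (z H.x₁) - y 0‖ ≤ K * (q * b) := by
        have := mul_le_mul_of_nonneg_left hzy hq0.le
        linarith
      have hball : H.slowReset ε (z H.x₁) ∈ Metric.closedBall H.x₂ ρ := by
        rw [mem_closedBall_iff_norm]
        have h1 : K * (q * b) ≤ K * b₀ := mul_le_mul_of_nonneg_left (by nlinarith) hKpos.le
        have h2 := norm_sub_le_norm_sub_add_norm_sub (H.slowReset ε (z H.x₁)) (y 0) H.x₂
        linarith
      obtain ⟨w, hw0, hw⟩ := hT.slow.exists_sol hT.zero_mem hball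
      obtain ⟨τw, hτw⟩ := hT.exists_hit hw
      have := hT.hit_pos hτw
      refine ⟨w, τw, hw, hτw, ?_, ?_, ?_, ?_⟩
      · rw [hcT, hR _ hg]
        constructor <;> linarith
      · rw [hcT, hR _ hg, hw0, hsr]
      · rwa [hw0]
      · rw [hcT, hR _ hg, neg_zero]; positivity
    · linarith [hx.1, hτm'.2]
    · intro s hs
      rw [hcs s hs]
      have hrs := hr s hs
      exact hT.infDist_le hy hz hτ hτ' hb hzy ⟨hx.1.trans hrs.1, hrs.2⟩ (by linarith [hrs.1])
  -- states near the orbit and not beyond the guard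
  set δ : ℝ := min (min b₀ (-α)) (min (h / 2) (ρ / 8)) with hδ
  have hδpos : 0 < δ := by
    simp only [hδ, lt_min_iff]
    exact ⟨⟨hb₀pos, by linarith⟩, by linarith, by linarith⟩
  -- The bounds in `δ` serve in turn: `b₀` for the budget in `N`, `-α` and `h / 2` to keep the phase
  -- in the tube, and `ρ / 8` to keep the slow part within `ρ / 8 + ρ / 8 + ρ / 2 < ρ` of `x₂`.
  have hnear : ∀ x ∈ H.preGuard ε, Metric.infDist x Γ < δ → N (Metric.infDist x Γ) x := by
    intro x hx hxδ
    set d := Metric.infDist x Γ with hd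
    have hd0 : 0 ≤ d := Metric.infDist_nonneg
    obtain ⟨⟨hdb, hdα⟩, hdh, hdρ⟩ : (d < b₀ ∧ d < -α) ∧ d < h / 2 ∧ d < ρ / 8 := by
      simpa only [hδ, lt_min_iff] using hxδ
    have hcomp : IsCompact Γ := isCompact_Icc.image_of_continuousOn
      (continuousOn_id.prodMk (hy.continuousOn.mono (Icc_subset_Icc hα.le hτm.2)))
    have hne : Γ.Nonempty := ⟨_, mem_image_of_mem _ (left_mem_Icc.2 (by linarith))⟩
    obtain ⟨w, ⟨s', hs', rfl⟩, hw⟩ := hcomp.exists_infDist_eq_dist hne x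
    rw [← hd, Prod.dist_eq] at hw
    simp only at hw
    have h1 : |x.1 - s'| ≤ d := by rw [hw, ← Real.dist_eq]; exact le_max_left _ _
    have h2 : ‖x.2 - y s'‖ ≤ d := by rw [hw, ← dist_eq_norm]; exact le_max_right _ _
    have h1' := abs_le.1 h1
    have hτu := hτ.mem.2
    have hxm : x.1 ∈ Icc α (H.x₁ + h) := by
      constructor
      · linarith [hs'.1, h1'.1]
      · linarith [hs'.2, h1'.2]
    have hsm : s' ∈ Icc α (H.x₁ + h) := ⟨by linarith [hs'.1], by linarith [hs'.2]⟩
    have hyρ := hT.slow.norm_sub_le_radius hy hT.zero_mem hsm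
    have hxball : x.2 ∈ Metric.closedBall H.x₂ ρ := by
      rw [mem_closedBall_iff_norm]
      have e1 := norm_sub_le_norm_sub_add_norm_sub x.2 (y s') H.x₂
      have e2 := norm_sub_le_norm_sub_add_norm_sub (y s') (y 0) H.x₂
      linarith
    obtain ⟨z, hzx, hz⟩ := hT.slow.exists_sol hxm hxball
    obtain ⟨τ', hτ'⟩ := hT.exists_hit hz
    refine ⟨hd0, hdb.le, z, τ', hz, hτ', ⟨hxm.1, ?_⟩, hzx, ?_, by linarith [hs'.1, h1'.1]⟩
    -- Past the crossing `sg * γ` is positive, but at `(0, x₂)` it is negative, which contradicts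
    -- the definition of `preGuard`.
    · by_contra! hlt
      have e1 := hτ'.pos x.1 ⟨hlt, hxm.2⟩
      rw [hzx] at e1
      have e2 := hT.neg 0 ⟨hα.le, by linarith⟩ H.x₂ (Metric.mem_closedBall_self (by linarith))
      have e3 := mul_neg_of_pos_of_neg e1 e2
      have e4 : 0 ≤ sg ^ 2 * (H.γ ε x * H.γ ε (0, H.x₂)) := mul_nonneg (sq_nonneg _) hx.2
      have e5 : sg * H.γ ε (x.1, x.2) * (sg * H.γ ε (0, H.x₂)) =
        sg ^ 2 * (H.γ ε x * H.γ ε (0, H.x₂)) := by ring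
      linarith
    · have e1 := (hT.slow.dist_sol_le hz hy hxm hT.zero_mem).1
      rw [hzx] at e1
      have e2 := norm_sub_le_norm_sub_add_norm_sub x.2 (y s') (y x.1)
      have e3 := hT.slow.norm_sub_le hy hxm hsm
      rw [abs_sub_comm] at e3
      have e4 := mul_le_mul_of_nonneg_left h1 hB
      rw [hK]
      linarith
  refine ⟨Γ, hT.isPeriodicOrbit hR hy hper hτ, δ, hδpos, ?_⟩
  set Tm : ℝ := 2 * (H.x₁ + h - α) with hTm
  have hTmpos : 0 < Tm := by rw [hTm]; linarith
  have hlog : Real.log q < 0 := Real.log_neg hq0 hq1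
  -- After `k` resets the bound is `q ^ k * d`, and the elapsed time is at most `(k + 1) * Tm`. The
  -- rate is therefore `-log q / Tm`, and the factor `1 / q` pays for the arc in progress.
  refine ⟨K₂ / q, by positivity, -Real.log q / Tm, div_pos (by linarith) hTmpos, ?_⟩
  intro x hx hxδ
  have hNx := hnear x hx hxδ
  set d := Metric.infDist x Γ with hd
  refine ⟨?_, ?_⟩
  · refine exists_execution (S := {x | ∃ b, N b x}) (t₀ := h / 3) (by linarith) ?_ hR ⟨d, hNx⟩
    rintro x ⟨b, hb⟩
    obtain ⟨T, c, hc, hc0, hT0⟩ := harc b x hb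
    exact ⟨T, c, hc, hc0, ⟨_, (hstep b x hb T c hc hc0).1⟩, hT0⟩
  · intro T c hexec k s hs
    have hNk : ∀ k, N (q ^ k * d) (c k 0) := by
      intro k
      induction k with
      | zero => simpa [hexec.init] using hNx
      | succ k ih =>
        have := (hstep _ _ ih _ _ (hexec.arc k) rfl).1
        rw [hexec.reset, pow_succ']
        rwa [← mul_assoc] at this
    have hTk : ∀ k, T k ≤ Tm := fun k => (hstep _ _ (hNk k) _ _ (hexec.arc k) rfl).2.1
    have hsum : (∑ j ∈ Finset.range k, T j) + s ≤ (k + 1) * Tm := by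
      have h1 : ∑ j ∈ Finset.range k, T j ≤ k * Tm := by
        have := Finset.sum_le_card_nsmul (Finset.range k) T Tm fun j _ => hTk j
        simpa using this
      linarith [hTk k, hs.2]
    have hexp : q ^ (k + 1) ≤
        Real.exp (-(-Real.log q / Tm) * ((∑ j ∈ Finset.range k, T j) + s)) := by
      rw [← Real.rpow_natCast, Real.rpow_def_of_pos hq0]
      refine Real.exp_le_exp.2 ?_
      have h1 := mul_le_mul_of_nonneg_left hsum (div_pos (neg_pos.2 hlog) hTmpos).le
      have h2 : -Real.log q / Tm * ((k + 1) * Tm) = -Real.log q * (k + 1) := by field_simp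
      push_cast
      linarith
    calc Metric.infDist (c k s) Γ ≤ K₂ * (q ^ k * d) :=
          (hstep _ _ (hNk k) _ _ (hexec.arc k) rfl).2.2 s hs
      _ = K₂ / q * q ^ (k + 1) * d := by field_simp; ring
      _ ≤ _ := by
        refine mul_le_mul_of_nonneg_right ?_ Metric.infDist_nonneg
        exact mul_le_mul_of_nonneg_left hexp (by positivity)

end IsTube

end SingleModeSystem

/-! ### Uniform closeness to the unperturbed system near `ε = 0`, `y = x₂*`. -/

section Partial

variable {V G : Type*} [NormedAddCommGroup V] [NormedSpace ℝ V] [NormedAddCommGroup G]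
  [NormedSpace ℝ G]

/-- The partial derivative of a map that is `C¹` up to the boundary of the parameter interval. -/
theorem exists_partial_fderiv {f : ℝ → V → G} {ε₀ : ℝ} {U : Set V} (hU : IsOpen U)
    (hf : ContDiffOn ℝ 1 (fun p : ℝ × V => f p.1 p.2) (Ico 0 ε₀ ×ˢ U)) :
    ∃ D : ℝ × V → V →L[ℝ] G, ContinuousOn D (Ico 0 ε₀ ×ˢ U) ∧
      ∀ ε ∈ Ico 0 ε₀, ∀ x ∈ U, HasFDerivAt (f ε) (D (ε, x)) x := by
  -- Derivatives within the half-open parameter interval are unique also at `ε = 0`, so the partial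
  -- derivative is continuous up to that boundary.
  have hu : UniqueDiffOn ℝ (Ico 0 ε₀ ×ˢ U) := (uniqueDiffOn_Ico 0 ε₀).prod hU.uniqueDiffOn
  refine ⟨fun p => (fderivWithin ℝ (fun p : ℝ × V => f p.1 p.2) (Ico 0 ε₀ ×ˢ U) p).comp
    (ContinuousLinearMap.inr ℝ ℝ V), ?_, fun ε hε x hx => ?_⟩
  · exact (hf.continuousOn_fderivWithin hu le_rfl).clm_comp continuousOn_const
  · have h1 := ((hf.differentiableOn one_ne_zero) (ε, x) ⟨hε, hx⟩).hasFDerivWithinAt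
    have h2 : HasFDerivWithinAt (fun y : V => (ε, y)) (ContinuousLinearMap.inr ℝ ℝ V) U x :=
      (hasFDerivAt_prodMk_right ε x).hasFDerivWithinAt
    exact (h1.comp x h2 fun y hy => ⟨hε, hy⟩).hasFDerivAt (hU.mem_nhds hx)

theorem ContDiffOn.slice {f : ℝ → V → G} {ε₀ : ℝ} {U : Set V} {k : WithTop ℕ∞}
    (hf : ContDiffOn ℝ k (fun p : ℝ × V => f p.1 p.2) (Ico 0 ε₀ ×ˢ U)) {ε : ℝ}
    (hε : ε ∈ Ico 0 ε₀) : ContDiffOn ℝ k (f ε) U :=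
  hf.comp (f := fun x => (ε, x)) (contDiff_prodMk_right ε).contDiffOn fun _ hx => ⟨hε, hx⟩

end Partial

namespace SingleModeSystem

variable {n : ℕ} {H : SingleModeSystem n} {ε₀ : ℝ}
  {S₀ : EuclideanSpace ℝ (Fin n) →L[ℝ] EuclideanSpace ℝ (Fin n)}
  {S₁ : EuclideanSpace ℝ (Fin n) → EuclideanSpace ℝ (Fin n) →L[ℝ] EuclideanSpace ℝ (Fin n)}

namespace IsAverageable

theorem isOpen_X (hH : H.IsAverageable ε₀ S₀ S₁) : IsOpen H.X := hH.isOpen_X₁.prod hH.isOpen_X₂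

theorem eventually_mem (hH : H.IsAverageable ε₀ S₀ S₁) {σ : ℝ} (hσ : σ ∈ H.X₁) :
    ∀ᶠ q in (𝓝[≥] (0 : ℝ) ×ˢ 𝓝 H.x₂) ×ˢ 𝓝 σ,
      ((q.1.1, (q.2, q.1.2)) : ℝ × (ℝ × EuclideanSpace ℝ (Fin n))) ∈ Ico 0 ε₀ ×ˢ H.X := by
  have h1 : ∀ᶠ e in 𝓝[≥] (0 : ℝ), e ∈ Ico 0 ε₀ := Ico_mem_nhdsGE hH.ε₀_pos
  have h2 : ∀ᶠ y in 𝓝 H.x₂, y ∈ H.X₂ := hH.isOpen_X₂.mem_nhds hH.x₂_mem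
  have h3 : ∀ᶠ s in 𝓝 σ, s ∈ H.X₁ := hH.isOpen_X₁.mem_nhds hσ
  filter_upwards [(h1.prod_mk h2).prod_mk h3] with q hq
  exact ⟨hq.1.1, hq.2, hq.1.2⟩

theorem tendsto_nhdsWithin (hH : H.IsAverageable ε₀ S₀ S₁) {σ : ℝ} (hσ : σ ∈ H.X₁) :
    Tendsto (fun q : (ℝ × EuclideanSpace ℝ (Fin n)) × ℝ => (q.1.1, (q.2, q.1.2)))
      ((𝓝[≥] (0 : ℝ) ×ˢ 𝓝 H.x₂) ×ˢ 𝓝 σ) (𝓝[Ico 0 ε₀ ×ˢ H.X] (0, (σ, H.x₂))) := by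
  refine tendsto_nhdsWithin_iff.2 ⟨?_, hH.eventually_mem hσ⟩
  rw [nhds_prod_eq, nhds_prod_eq]
  have h0 : Tendsto (fun e : ℝ => e) (𝓝[≥] 0) (𝓝 0) := tendsto_id.mono_left nhdsWithin_le_nhds
  exact (h0.comp (tendsto_fst.comp tendsto_fst)).prodMk
    (tendsto_snd.prodMk (tendsto_snd.comp tendsto_fst))

theorem continuousWithinAt_phase {Z : Type*} [TopologicalSpace Z]
    (hH : H.IsAverageable ε₀ S₀ S₁) {φ : ℝ × (ℝ × EuclideanSpace ℝ (Fin n)) → Z} {σ : ℝ}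
    (hσ : σ ∈ H.X₁) (hφ : ContinuousWithinAt φ (Ico 0 ε₀ ×ˢ H.X) (0, (σ, H.x₂))) :
    ContinuousAt (fun s => φ (0, (s, H.x₂))) σ := by
  refine Tendsto.comp (f := fun s => ((0 : ℝ), (s, H.x₂))) hφ (tendsto_nhdsWithin_iff.2 ⟨?_, ?_⟩)
  · exact Continuous.tendsto (by fun_prop) σ
  · filter_upwards [hH.isOpen_X₁.mem_nhds hσ] with s hs
    exact ⟨⟨le_rfl, hH.ε₀_pos⟩, hs, hH.x₂_mem⟩

/-- A map that is continuous at `ε = 0`, `y = x₂*` is uniformly close to its value there. -/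
theorem eventually_norm_sub_lt {Z : Type*} [NormedAddCommGroup Z] (hH : H.IsAverageable ε₀ S₀ S₁)
    {φ : ℝ × (ℝ × EuclideanSpace ℝ (Fin n)) → Z} {a b η : ℝ} (hab : Icc a b ⊆ H.X₁)
    (hφ : ∀ σ ∈ Icc a b, ContinuousWithinAt φ (Ico 0 ε₀ ×ˢ H.X) (0, (σ, H.x₂))) (hη : 0 < η) :
    ∀ᶠ q in 𝓝[≥] (0 : ℝ) ×ˢ 𝓝 H.x₂, ∀ σ ∈ Icc a b,
      ‖φ (q.1, (σ, q.2)) - φ (0, (σ, H.x₂))‖ < η := by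
  have key : {q : (ℝ × EuclideanSpace ℝ (Fin n)) × ℝ |
      ‖φ (q.1.1, (q.2, q.1.2)) - φ (0, (q.2, H.x₂))‖ < η} ∈
      (𝓝[≥] (0 : ℝ) ×ˢ 𝓝 H.x₂) ×ˢ 𝓝ˢ (Icc a b) := by
    -- Tube lemma: closeness near each single phase becomes uniform over the compact phase interval.
    refine isCompact_Icc.mem_prod_nhdsSet_of_forall fun σ hσ => ?_
    have h1 : Tendsto (fun q : (ℝ × EuclideanSpace ℝ (Fin n)) × ℝ => φ (q.1.1, (q.2, q.1.2)))
        ((𝓝[≥] (0 : ℝ) ×ˢ 𝓝 H.x₂) ×ˢ 𝓝 σ) (𝓝 (φ (0, (σ, H.x₂)))) :=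
      (hφ σ hσ).tendsto.comp (hH.tendsto_nhdsWithin (hab hσ))
    have h2 : Tendsto (fun q : (ℝ × EuclideanSpace ℝ (Fin n)) × ℝ => φ (0, (q.2, H.x₂)))
        ((𝓝[≥] (0 : ℝ) ×ˢ 𝓝 H.x₂) ×ˢ 𝓝 σ) (𝓝 (φ (0, (σ, H.x₂)))) :=
      (hH.continuousWithinAt_phase (hab hσ) (hφ σ hσ)).tendsto.comp tendsto_snd
    have h3 := (h1.sub h2).norm
    rw [sub_self, norm_zero] at h3
    exact h3.eventually_lt_const hη
  obtain ⟨t, ht, u, hu, htu⟩ := mem_prod_iff.1 key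
  filter_upwards [ht] with q hq σ hσ
  exact htu (mk_mem_prod hq (subset_of_mem_nhdsSet hu hσ))

theorem eventually_mem_X (hH : H.IsAverageable ε₀ S₀ S₁) {a b : ℝ} (hab : Icc a b ⊆ H.X₁) :
    ∀ᶠ q in 𝓝[≥] (0 : ℝ) ×ˢ 𝓝 H.x₂, q.1 ∈ Ico 0 ε₀ ∧ ∀ σ ∈ Icc a b, (σ, q.2) ∈ H.X := by
  have h1 : ∀ᶠ e in 𝓝[≥] (0 : ℝ), e ∈ Ico 0 ε₀ := Ico_mem_nhdsGE hH.ε₀_pos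
  have h2 : ∀ᶠ y in 𝓝 H.x₂, y ∈ H.X₂ := hH.isOpen_X₂.mem_nhds hH.x₂_mem
  filter_upwards [h1.prod_mk h2] with q hq
  exact ⟨hq.1, fun σ hσ => ⟨hab hσ, hq.2⟩⟩

theorem zero_mem_Ico (hH : H.IsAverageable ε₀ S₀ S₁) : (0 : ℝ) ∈ Ico 0 ε₀ := ⟨le_rfl, hH.ε₀_pos⟩

/-- The guard at `ε = 0` near the segment from `(0, x₂*)` to `x*`. -/
theorem exists_guard_constants (hH : H.IsAverageable ε₀ S₀ S₁) :
    ∃ α h sg m, α < 0 ∧ 0 < h ∧ h ≤ H.x₁ ∧ Icc α (H.x₁ + h) ⊆ H.X₁ ∧ 0 < m ∧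
      (∀ σ ∈ Icc α (H.x₁ - h / 3), sg * H.γ 0 (σ, H.x₂) < 0) ∧
      0 < sg * H.γ 0 (H.x₁ + h / 3, H.x₂) ∧
      ∀ σ ∈ Icc (H.x₁ - h / 3) (H.x₁ + h), 2 * m ≤ sg * fderiv ℝ (H.γ 0) (σ, H.x₂) (1, 0) := by
  have h0 := hH.zero_mem_Ico
  have hx1 := hH.x₁_pos
  obtain ⟨D, hDc, hD⟩ := exists_partial_fderiv hH.isOpen_X hH.contDiffOn_γ
  have hX : ∀ σ ∈ H.X₁, (σ, H.x₂) ∈ H.X := fun σ hσ => ⟨hσ, hH.x₂_mem⟩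
  have hDf : ∀ σ ∈ H.X₁, fderiv ℝ (H.γ 0) (σ, H.x₂) = D (0, (σ, H.x₂)) := fun σ hσ =>
    (hD 0 h0 _ (hX σ hσ)).fderiv
  -- Taking the phase derivative of `γ` at `x*` itself as the factor makes `sg * ∂₁γ` equal to `sg ^
  -- 2 > 0` there, with no distinction of signs.
  set sg : ℝ := D (0, (H.x₁, H.x₂)) (1, 0) with hsg
  have hsg0 : sg ≠ 0 := by
    rw [hsg, ← hDf _ hH.x₁_mem]
    exact hH.transverse 0 h0 _ (hH.mem_guard 0 h0)
  have hsq : 0 < sg * sg := mul_self_pos.2 hsg0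
  have hdc : ContinuousAt (fun s => sg * D (0, (s, H.x₂)) (1, 0)) H.x₁ :=
    ((hH.continuousWithinAt_phase hH.x₁_mem
      (hDc _ ⟨h0, hX _ hH.x₁_mem⟩)).clm_apply continuousAt_const).const_mul sg
  have hev : ∀ᶠ s in 𝓝 H.x₁, s ∈ H.X₁ ∧ sg * sg / 2 < sg * D (0, (s, H.x₂)) (1, 0) :=
    (hH.isOpen_X₁.eventually_mem hH.x₁_mem).and (hdc.eventually_const_lt (half_lt_self hsq))
  obtain ⟨r, hr, hball⟩ := Metric.eventually_nhds_iff_ball.1 hev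
  set h := min (r / 2) H.x₁ with hh
  have hhr : h < r := lt_of_le_of_lt (min_le_left _ _) (by linarith)
  have hhx : h ≤ H.x₁ := min_le_right _ _
  have hhpos : 0 < h := lt_min (by linarith) hx1
  have hnear : ∀ σ ∈ Icc (H.x₁ - h) (H.x₁ + h), σ ∈ H.X₁ ∧
      sg * sg / 2 < sg * D (0, (σ, H.x₂)) (1, 0) := fun σ hσ => hball σ (by
    rw [Metric.mem_ball, Real.dist_eq, abs_lt]; constructor <;> linarith [hσ.1, hσ.2])
  set g : ℝ → ℝ := fun σ => sg * H.γ 0 (σ, H.x₂) with hg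
  have hgd : ∀ σ ∈ H.X₁, HasDerivAt g (sg * D (0, (σ, H.x₂)) (1, 0)) σ := fun σ hσ => by
    have h1 : HasDerivAt (fun σ : ℝ => (σ, H.x₂)) (1, 0) σ :=
      (hasDerivAt_id σ).prodMk (hasDerivAt_const σ H.x₂)
    exact ((hD 0 h0 _ (hX σ hσ)).comp_hasDerivAt σ h1).const_mul sg
  have hgc : ContinuousOn g H.X₁ := fun σ hσ => (hgd σ hσ).continuousAt.continuousWithinAt
  have hmono : StrictMonoOn g (Icc (H.x₁ - h) (H.x₁ + h)) := by
    refine strictMonoOn_of_deriv_pos (convex_Icc _ _)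
      (hgc.mono fun σ hσ => (hnear σ hσ).1) fun σ hσ => ?_
    have := hnear σ (interior_subset hσ)
    rw [(hgd σ this.1).deriv]
    linarith [this.2]
  have hgx : g H.x₁ = 0 := by
    have := (hH.mem_guard 0 h0).2
    simp only [hg, this, mul_zero]
  have hsub : Icc 0 H.x₁ ⊆ H.X₁ := hH.ordConnected_X₁.out hH.zero_mem_X₁ hH.x₁_mem
  have hgl : g (H.x₁ - h) < 0 := by
    rw [← hgx]; exact hmono ⟨le_rfl, by linarith⟩ ⟨by linarith, by linarith⟩ (by linarith)
  -- `g` is negative just before `x₁`, and a change of sign on `[0, x₁)` would put a guard point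
  -- there.
  have hneg : ∀ s ∈ Ico 0 H.x₁, g s < 0 := by
    intro s hs
    by_contra! hle
    have hsub' : uIcc (H.x₁ - h) s ⊆ Ico 0 H.x₁ := fun u hu => by
      rw [mem_uIcc] at hu
      rcases hu with hu | hu <;> constructor <;> linarith [hs.1, hs.2, hu.1, hu.2]
    obtain ⟨u, hu, hu0⟩ : (0 : ℝ) ∈ g '' uIcc (H.x₁ - h) s :=
      intermediate_value_uIcc (hgc.mono (hsub'.trans (Ico_subset_Icc_self.trans hsub)))
        (by rw [mem_uIcc]; exact Or.inl ⟨hgl.le, hle⟩)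
    exact hH.not_mem_guard u (hsub' hu) ⟨hX u (hsub (Ico_subset_Icc_self (hsub' hu))),
      (mul_eq_zero.1 hu0).resolve_left hsg0⟩
  have hev0 : ∀ᶠ s in 𝓝 (0 : ℝ), s ∈ H.X₁ ∧ g s < 0 :=
    (hH.isOpen_X₁.eventually_mem hH.zero_mem_X₁).and
      ((hgd 0 hH.zero_mem_X₁).continuousAt.eventually_lt_const (hneg 0 ⟨le_rfl, hx1⟩))
  obtain ⟨r₀, hr₀, hball₀⟩ := Metric.eventually_nhds_iff_ball.1 hev0
  have hα : ∀ s ∈ Icc (-(r₀ / 2)) 0, s ∈ H.X₁ ∧ g s < 0 := fun s hs => hball₀ s (by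
    rw [Metric.mem_ball, Real.dist_eq, abs_lt]; constructor <;> linarith [hs.1, hs.2])
  -- The derivative exceeds `sg ^ 2 / 2 = 2 m`; half of this is kept in reserve for the perturbation
  -- in `ε` and `y`.
  refine ⟨-(r₀ / 2), h, sg, sg * sg / 4, by linarith, hhpos, hhx, ?_, by linarith, ?_, ?_, ?_⟩
  · exact hH.ordConnected_X₁.out (hα _ ⟨le_rfl, by linarith⟩).1 (hnear _ ⟨by linarith, le_rfl⟩).1
  · intro σ hσ
    rcases le_total σ 0 with h1 | h1
    · exact (hα σ ⟨hσ.1, h1⟩).2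
    · exact hneg σ ⟨h1, by linarith [hσ.2]⟩
  · show 0 < g (H.x₁ + h / 3)
    rw [← hgx]
    exact hmono ⟨by linarith, by linarith⟩ ⟨by linarith, by linarith⟩ (by linarith)
  · intro σ hσ
    have := hnear σ ⟨by linarith [hσ.1], hσ.2⟩
    rw [hDf σ this.1]
    linarith [this.2]

end IsAverageable

/-- The first-order phase velocity of the slow coordinates: `slope = ε • relSlope`. -/
noncomputable def relSlope (H : SingleModeSystem n) (ε σ : ℝ) (y : EuclideanSpace ℝ (Fin n)) :
    EuclideanSpace ℝ (Fin n) :=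
  (1 + ε * H.F₁ ε (σ, y))⁻¹ • H.F₂ ε (σ, y)

theorem slope_eq (H : SingleModeSystem n) (ε σ : ℝ) (y : EuclideanSpace ℝ (Fin n)) :
    H.slope ε σ y = ε • H.relSlope ε σ y := by
  rw [slope, relSlope, smul_smul, div_eq_mul_inv]

theorem relSlope_zero (H : SingleModeSystem n) (σ : ℝ) (y : EuclideanSpace ℝ (Fin n)) :
    H.relSlope 0 σ y = H.F₂ 0 (σ, y) := by
  simp [relSlope]

namespace IsAverageable

theorem continuousWithinAt_speed (hH : H.IsAverageable ε₀ S₀ S₁) {σ : ℝ} (hσ : σ ∈ H.X₁) :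
    ContinuousWithinAt (fun p : ℝ × (ℝ × EuclideanSpace ℝ (Fin n)) => p.1 * H.F₁ p.1 p.2)
      (Ico 0 ε₀ ×ˢ H.X) (0, (σ, H.x₂)) :=
  continuous_fst.continuousWithinAt.mul
    (hH.contDiffOn_F₁.continuousOn _ ⟨hH.zero_mem_Ico, hσ, hH.x₂_mem⟩)

theorem continuousWithinAt_relSlope (hH : H.IsAverageable ε₀ S₀ S₁) {σ : ℝ} (hσ : σ ∈ H.X₁) :
    ContinuousWithinAt (fun p : ℝ × (ℝ × EuclideanSpace ℝ (Fin n)) => H.relSlope p.1 p.2.1 p.2.2)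
      (Ico 0 ε₀ ×ˢ H.X) (0, (σ, H.x₂)) :=
  ((continuousWithinAt_const.add (hH.continuousWithinAt_speed hσ)).inv₀ (by simp)).smul
    (hH.contDiffOn_F₂.continuousOn _ ⟨hH.zero_mem_Ico, hσ, hH.x₂_mem⟩)

theorem eventually_speed (hH : H.IsAverageable ε₀ S₀ S₁) {a b : ℝ} (hab : Icc a b ⊆ H.X₁) :
    ∀ᶠ q in 𝓝[≥] (0 : ℝ) ×ˢ 𝓝 H.x₂, ∀ σ ∈ Icc a b, |q.1 * H.F₁ q.1 (σ, q.2)| ≤ 1 / 2 := by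
  filter_upwards [hH.eventually_norm_sub_lt hab
    (fun σ hσ => hH.continuousWithinAt_speed (hab hσ)) (half_pos one_pos)] with q hq σ hσ
  have := hq σ hσ
  simp only [zero_mul, sub_zero, Real.norm_eq_abs] at this
  exact this.le

/-- The relative slope is close to `F₂` at `ε = 0`, `y = x₂*`. -/
theorem eventually_relSlope (hH : H.IsAverageable ε₀ S₀ S₁) {a b η : ℝ} (hab : Icc a b ⊆ H.X₁)
    (hη : 0 < η) :
    ∀ᶠ q in 𝓝[≥] (0 : ℝ) ×ˢ 𝓝 H.x₂, ∀ σ ∈ Icc a b,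
      ‖H.relSlope q.1 σ q.2 - H.F₂ 0 (σ, H.x₂)‖ < η := by
  filter_upwards [hH.eventually_norm_sub_lt hab
    (fun σ hσ => hH.continuousWithinAt_relSlope (hab hσ)) hη] with q hq σ hσ
  simpa only [relSlope_zero] using hq σ hσ

/-- The derivative of `F₂` in the slow coordinates at `ε = 0`, `y = x₂*`. -/
noncomputable def _root_.SingleModeSystem.slowDeriv (H : SingleModeSystem n) (σ : ℝ) :
    EuclideanSpace ℝ (Fin n) →L[ℝ] EuclideanSpace ℝ (Fin n) :=
  (fderiv ℝ (H.F₂ 0) (σ, H.x₂)).comp (ContinuousLinearMap.inr ℝ ℝ (EuclideanSpace ℝ (Fin n)))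

theorem continuousOn_slowDeriv (hH : H.IsAverageable ε₀ S₀ S₁) :
    ContinuousOn H.slowDeriv H.X₁ := by
  have h1 : ContDiffOn ℝ 1 (H.F₂ 0) H.X :=
    (hH.contDiffOn_F₂.of_le one_le_two).slice hH.zero_mem_Ico
  have h2 := h1.continuousOn_fderiv_of_isOpen hH.isOpen_X le_rfl
  exact (h2.comp (continuousOn_id.prodMk continuousOn_const) fun σ hσ =>
    ⟨hσ, hH.x₂_mem⟩).clm_comp continuousOn_const

/-- The derivative of the relative slope in the slow coordinates is close to that of `F₂` at
`ε = 0`, `y = x₂*`. -/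
theorem eventually_hasFDerivAt_relSlope (hH : H.IsAverageable ε₀ S₀ S₁) {a b η : ℝ}
    (hab : Icc a b ⊆ H.X₁) (hη : 0 < η) :
    ∀ᶠ q in 𝓝[≥] (0 : ℝ) ×ˢ 𝓝 H.x₂, ∀ σ ∈ Icc a b,
      ∃ D, HasFDerivAt (H.relSlope q.1 σ) D q.2 ∧ ‖D - H.slowDeriv σ‖ ≤ η := by
  obtain ⟨D₁, hD₁c, hD₁⟩ :=
    exists_partial_fderiv hH.isOpen_X (hH.contDiffOn_F₁.of_le one_le_two)
  obtain ⟨D₂, hD₂c, hD₂⟩ :=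
    exists_partial_fderiv hH.isOpen_X (hH.contDiffOn_F₂.of_le one_le_two)
  set ι := ContinuousLinearMap.inr ℝ ℝ (EuclideanSpace ℝ (Fin n)) with hι
  -- The product rule for `relSlope`, as a function continuous up to `ε = 0`, where it reduces to
  -- `slowDeriv`.
  set φ : ℝ × (ℝ × EuclideanSpace ℝ (Fin n)) →
      EuclideanSpace ℝ (Fin n) →L[ℝ] EuclideanSpace ℝ (Fin n) := fun p =>
    (1 + p.1 * H.F₁ p.1 p.2)⁻¹ • (D₂ p).comp ι +
      ((-((1 + p.1 * H.F₁ p.1 p.2) ^ 2)⁻¹) • (p.1 • (D₁ p).comp ι)).smulRight (H.F₂ p.1 p.2)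
    with hφ
  have hφc : ∀ σ ∈ Icc a b, ContinuousWithinAt φ (Ico 0 ε₀ ×ˢ H.X) (0, (σ, H.x₂)) := by
    intro σ hσ
    have hm : ((0, (σ, H.x₂)) : ℝ × (ℝ × EuclideanSpace ℝ (Fin n))) ∈ Ico 0 ε₀ ×ˢ H.X :=
      ⟨hH.zero_mem_Ico, hab hσ, hH.x₂_mem⟩
    have hsp := (continuousWithinAt_const (b := (1 : ℝ))).add
      (hH.continuousWithinAt_speed (hab hσ))
    have h1 := (hsp.inv₀ (by simp)).smul ((hD₂c _ hm).clm_comp (continuousWithinAt_const (b := ι)))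
    have h2 := ((hsp.pow 2).inv₀ (by simp)).neg.smul
      (continuous_fst.continuousWithinAt.smul
        ((hD₁c _ hm).clm_comp (continuousWithinAt_const (b := ι))))
    have h3 : Continuous fun q : (EuclideanSpace ℝ (Fin n) →L[ℝ] ℝ) × EuclideanSpace ℝ (Fin n) =>
        q.1.smulRight q.2 :=
      isBoundedBilinearMap_smulRight.continuous
    exact h1.add (h3.continuousAt.comp_continuousWithinAt
      (h2.prodMk (hH.contDiffOn_F₂.continuousOn _ hm)))
  filter_upwards [hH.eventually_norm_sub_lt hab hφc hη, hH.eventually_mem_X hab,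
    hH.eventually_speed hab] with q hq hqX hqs σ hσ
  have hX := hqX.2 σ hσ
  have hne : 1 + q.1 * H.F₁ q.1 (σ, q.2) ≠ 0 := by
    have := (abs_le.1 (hqs σ hσ)).1
    intro h0
    linarith
  have hι' : HasFDerivAt (fun y : EuclideanSpace ℝ (Fin n) => (σ, y)) ι q.2 :=
    hasFDerivAt_prodMk_right σ q.2
  have e1 : HasFDerivAt (fun y => H.F₁ q.1 (σ, y)) ((D₁ (q.1, (σ, q.2))).comp ι) q.2 :=
    (hD₁ q.1 hqX.1 _ hX).comp q.2 hι'
  have e2 : HasFDerivAt (fun y => H.F₂ q.1 (σ, y)) ((D₂ (q.1, (σ, q.2))).comp ι) q.2 :=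
    (hD₂ q.1 hqX.1 _ hX).comp q.2 hι'
  have e3 : HasFDerivAt (fun y => (1 + q.1 * H.F₁ q.1 (σ, y))⁻¹)
      ((-((1 + q.1 * H.F₁ q.1 (σ, q.2)) ^ 2)⁻¹) • (q.1 • (D₁ (q.1, (σ, q.2))).comp ι)) q.2 :=
    (hasDerivAt_inv hne).comp_hasFDerivAt q.2 ((e1.const_mul q.1).const_add 1)
  refine ⟨φ (q.1, (σ, q.2)), e3.smul e2, ?_⟩
  have hS : H.slowDeriv σ = φ (0, (σ, H.x₂)) := by
    rw [slowDeriv, (hD₂ 0 hH.zero_mem_Ico (σ, H.x₂) ⟨hab hσ, hH.x₂_mem⟩).fderiv]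
    simp [hφ, hι]
  rw [hS]
  exact (hq σ hσ).le

/-- The guard conditions of a tube hold for small `ε` close to `x₂*`. -/
theorem eventually_guard (hH : H.IsAverageable ε₀ S₀ S₁) {α h sg m : ℝ} (hα : α < 0)
    (hh : 0 < h) (hhx : h ≤ H.x₁) (hX₁ : Icc α (H.x₁ + h) ⊆ H.X₁) (hm : 0 < m)
    (hneg : ∀ σ ∈ Icc α (H.x₁ - h / 3), sg * H.γ 0 (σ, H.x₂) < 0)
    (hpos : 0 < sg * H.γ 0 (H.x₁ + h / 3, H.x₂))
    (hder : ∀ σ ∈ Icc (H.x₁ - h / 3) (H.x₁ + h),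
      2 * m ≤ sg * fderiv ℝ (H.γ 0) (σ, H.x₂) (1, 0)) :
    ∃ C, 0 ≤ C ∧ ∀ᶠ q in 𝓝[≥] (0 : ℝ) ×ˢ 𝓝 H.x₂,
      (∀ σ ∈ Icc α (H.x₁ - h / 3), sg * H.γ q.1 (σ, q.2) < 0) ∧
      0 < sg * H.γ q.1 (H.x₁ + h / 3, q.2) ∧
      ∀ σ ∈ Icc (H.x₁ - h / 3) (H.x₁ + h), ∃ D : ℝ × EuclideanSpace ℝ (Fin n) →L[ℝ] ℝ,
        HasFDerivAt (H.γ q.1) D (σ, q.2) ∧ m ≤ sg * D (1, H.slope q.1 σ q.2) ∧ ‖D‖ ≤ C := by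
  have hsub1 : Icc α (H.x₁ - h / 3) ⊆ H.X₁ := (Icc_subset_Icc_right (by linarith)).trans hX₁
  have hsub2 : Icc (H.x₁ - h / 3) (H.x₁ + h) ⊆ H.X₁ :=
    (Icc_subset_Icc_left (by linarith)).trans hX₁
  have hmem : ∀ σ ∈ H.X₁, ((0, (σ, H.x₂)) : ℝ × (ℝ × EuclideanSpace ℝ (Fin n))) ∈
      Ico 0 ε₀ ×ˢ H.X := fun σ hσ => ⟨hH.zero_mem_Ico, hσ, hH.x₂_mem⟩
  obtain ⟨D, hDc, hD⟩ := exists_partial_fderiv hH.isOpen_X hH.contDiffOn_γ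
  have hγc : ∀ σ ∈ H.X₁, ContinuousWithinAt
      (fun p : ℝ × (ℝ × EuclideanSpace ℝ (Fin n)) => sg * H.γ p.1 p.2) (Ico 0 ε₀ ×ˢ H.X)
      (0, (σ, H.x₂)) := fun σ hσ =>
    continuousWithinAt_const.mul (hH.contDiffOn_γ.continuousOn _ (hmem σ hσ))
  have hγ0 : ContinuousOn (fun σ => sg * H.γ 0 (σ, H.x₂)) H.X₁ := fun σ hσ =>
    (hH.continuousWithinAt_phase hσ (hγc σ hσ)).continuousWithinAt
  -- By compactness the negative guard values are bounded away from `0`; this gap is the allowed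
  -- perturbation.
  obtain ⟨s, hs, hsmax⟩ := isCompact_Icc.exists_isMaxOn ⟨α, le_rfl, by linarith⟩ (hγ0.mono hsub1)
  have hμ : 0 < -(sg * H.γ 0 (s, H.x₂)) := by linarith [hneg s hs]
  -- At `ε = 0` the trajectory direction `(1, slope)` is `(1, 0)`, so the derivative along
  -- trajectories starts from at least `2 m` and stays above `m`.
  have hsl : ∀ σ ∈ H.X₁, ContinuousWithinAt (fun p : ℝ × (ℝ × EuclideanSpace ℝ (Fin n)) =>
      sg * D p (1, p.1 • H.relSlope p.1 p.2.1 p.2.2)) (Ico 0 ε₀ ×ˢ H.X) (0, (σ, H.x₂)) :=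
    fun σ hσ => continuousWithinAt_const.mul ((hDc _ (hmem σ hσ)).clm_apply
      (continuousWithinAt_const.prodMk
        (continuous_fst.continuousWithinAt.smul (hH.continuousWithinAt_relSlope hσ))))
  have hD0 : ContinuousOn (fun σ => D (0, (σ, H.x₂))) H.X₁ := fun σ hσ =>
    (hH.continuousWithinAt_phase hσ (hDc _ (hmem σ hσ))).continuousWithinAt
  obtain ⟨C, hC⟩ := isCompact_Icc.exists_bound_of_continuousOn (hD0.mono hsub2)
  have hC0 : 0 ≤ C := (norm_nonneg _).trans (hC H.x₁ ⟨by linarith, by linarith⟩)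
  refine ⟨C + 1, by linarith, ?_⟩
  filter_upwards [hH.eventually_norm_sub_lt hsub1 (fun σ hσ => hγc σ (hsub1 hσ)) hμ,
    hH.eventually_norm_sub_lt hsub2 (fun σ hσ => hγc σ (hsub2 hσ)) hpos,
    hH.eventually_norm_sub_lt hsub2 (fun σ hσ => hsl σ (hsub2 hσ)) hm,
    hH.eventually_norm_sub_lt hsub2 (fun σ hσ => hDc _ (hmem σ (hsub2 hσ))) one_pos,
    hH.eventually_mem_X hsub2] with q h1 h2 h3 h4 h5
  refine ⟨fun σ hσ => ?_, ?_, fun σ hσ => ⟨D (q.1, (σ, q.2)), hD _ h5.1 _ (h5.2 σ hσ), ?_, ?_⟩⟩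
  · have e1 := (abs_lt.1 (h1 σ hσ)).2
    have e2 : sg * H.γ 0 (σ, H.x₂) ≤ sg * H.γ 0 (s, H.x₂) := hsmax hσ
    linarith
  · have e1 := (abs_lt.1 (h2 (H.x₁ + h / 3) ⟨by linarith, by linarith⟩)).1
    linarith
  · have e1 := (abs_lt.1 (h3 σ hσ)).1
    have e2 := hder σ hσ
    rw [(hD 0 hH.zero_mem_Ico (σ, H.x₂) ⟨hsub2 hσ, hH.x₂_mem⟩).fderiv] at e2
    simp only [zero_smul] at e1
    rw [slope_eq]
    linarith
  · have e1 := norm_sub_norm_le (D (q.1, (σ, q.2))) (D (0, (σ, H.x₂)))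
    linarith [h4 σ hσ, hC σ hσ]

end IsAverageable

end SingleModeSystem

/-! ### The linear estimate behind the contraction. -/

section Linear

variable {E : Type*} [NormedAddCommGroup E] [InnerProductSpace ℝ E]

/-- Compactness of the unit sphere and homogeneity. In the trivial space the sphere is empty and any
`c` works. -/
theorem exists_inner_le_neg_mul_sq [FiniteDimensional ℝ E] {Q : E →L[ℝ] E}
    (hQ : ∀ v, v ≠ 0 → inner ℝ v (Q v) < 0) : ∃ c > 0, ∀ v, inner ℝ v (Q v) ≤ -c * ‖v‖ ^ 2 := by
  rcases (Metric.sphere (0 : E) 1).eq_empty_or_nonempty with he | hne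
  · refine ⟨1, one_pos, fun v => ?_⟩
    by_cases hv : v = 0
    · simp [hv]
    · have : ‖v‖⁻¹ • v ∈ Metric.sphere (0 : E) 1 := by
        rw [mem_sphere_zero_iff_norm, norm_smul, norm_inv, norm_norm,
          inv_mul_cancel₀ (norm_ne_zero_iff.2 hv)]
      rw [he] at this
      exact absurd this (notMem_empty _)
  · have hcont : Continuous fun v : E => inner ℝ v (Q v) := continuous_id.inner Q.continuous
    obtain ⟨w, hw, hmax⟩ := (isCompact_sphere (0 : E) 1).exists_isMaxOn hne hcont.continuousOn
    have hw0 : w ≠ 0 := by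
      rintro rfl
      simp at hw
    refine ⟨-inner ℝ w (Q w), neg_pos.2 (hQ w hw0), fun v => ?_⟩
    by_cases hv : v = 0
    · simp [hv]
    · have hnv : ‖v‖ ≠ 0 := norm_ne_zero_iff.2 hv
      have h1 : ‖v‖⁻¹ • v ∈ Metric.sphere (0 : E) 1 := by
        rw [mem_sphere_zero_iff_norm, norm_smul, norm_inv, norm_norm, inv_mul_cancel₀ hnv]
      have h2 : inner ℝ (‖v‖⁻¹ • v) (Q (‖v‖⁻¹ • v)) ≤ inner ℝ w (Q w) := hmax h1
      rw [map_smul, real_inner_smul_left, real_inner_smul_right] at h2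
      have h3 := mul_le_mul_of_nonneg_right h2 (sq_nonneg ‖v‖)
      have h4 : ‖v‖⁻¹ * (‖v‖⁻¹ * inner ℝ v (Q v)) * ‖v‖ ^ 2 = inner ℝ v (Q v) := by
        field_simp
      rw [neg_neg]
      linarith

/-- Expanding the square gives the factor `1 - 2εc + ε²‖W‖² ≤ 1 - εc ≤ (1 - εc/2)²`. -/
theorem norm_add_smul_le {W : E →L[ℝ] E} {ε c : ℝ} (hc : ∀ v, inner ℝ v (W v) ≤ -c * ‖v‖ ^ 2)
    (hε : 0 < ε) (hεc : ε * c ≤ 1) (hW : ε * ‖W‖ ^ 2 ≤ c) (u : E) :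
    ‖u + ε • W u‖ ≤ (1 - ε * c / 2) * ‖u‖ := by
  have h1 : ‖u + ε • W u‖ ^ 2 ≤ ((1 - ε * c / 2) * ‖u‖) ^ 2 := by
    rw [norm_add_sq_real, real_inner_smul_right, norm_smul, Real.norm_of_nonneg hε.le]
    have h2 : ‖W u‖ ^ 2 ≤ ‖W‖ ^ 2 * ‖u‖ ^ 2 := by
      rw [← mul_pow]
      exact pow_le_pow_left₀ (norm_nonneg _) (W.le_opNorm u) 2
    have h3 := mul_le_mul_of_nonneg_left (hc u) hε.le
    have h4 := mul_le_mul_of_nonneg_left h2 (sq_nonneg ε)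
    have h5 := mul_le_mul_of_nonneg_right (mul_le_mul_of_nonneg_left hW hε.le) (sq_nonneg ‖u‖)
    have h6 := mul_nonneg (sq_nonneg (ε * c / 2)) (sq_nonneg ‖u‖)
    nlinarith
  exact le_of_sq_le_sq h1 (mul_nonneg (by linarith) (norm_nonneg _))

/-- A first-order perturbation of an isometry is contracting if its symmetric part is negative. -/
theorem norm_le_of_first_order {S₀ S₁ M W : E →L[ℝ] E} {ε c : ℝ} {u w s : E}
    (hS₀ : ∀ v, ‖S₀ v‖ = ‖v‖) (hSW : ∀ v, S₀ (W v) = S₁ v + S₀ (M v))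
    (hc : ∀ v, inner ℝ v (W v) ≤ -c * ‖v‖ ^ 2) (hc0 : 0 < c) (hε : 0 < ε) (hεc : ε * c ≤ 1)
    (hW : ε * ‖W‖ ^ 2 ≤ c) (hS₁ : ε * ‖S₁‖ ≤ 1) (hM : ε * (‖S₁‖ * ‖M‖) ≤ c / 16)
    (hw : ‖w - (u + ε • M u)‖ ≤ ε * (c / 16) * ‖u‖)
    (hs : ‖s - (S₀ + ε • S₁) w‖ ≤ ε * (c / 32) * ‖w‖) (hwu : ‖w‖ ≤ 2 * ‖u‖) :
    ‖s‖ ≤ (1 - ε * (c / 4)) * ‖u‖ := by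
  set e := w - (u + ε • M u) with he
  set f := s - (S₀ + ε • S₁) w with hf
  have hwe : w = u + ε • M u + e := by rw [he]; abel
  -- The main term has norm at most `(1 - εc/2) ‖u‖`, as `S₀` is isometric. Each of the four
  -- remainders costs at most `εc/16`, in all `εc/4`.
  have hse : s = S₀ (u + ε • W u) + (S₀ e + (ε • ε • S₁ (M u) + (ε • S₁ e + f))) := by
    have h1 : s = (S₀ + ε • S₁) w + f := by rw [hf]; abel
    rw [h1, hwe]
    simp only [add_apply, smul_apply, map_add, map_smul,
      smul_add, hSW]
    abel
  have hu := norm_nonneg u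
  have h1 := norm_add_smul_le hc hε hεc hW u
  have h2 : ‖ε • ε • S₁ (M u)‖ ≤ ε * (c / 16) * ‖u‖ := by
    rw [norm_smul, norm_smul, Real.norm_of_nonneg hε.le]
    have e1 : ‖S₁ (M u)‖ ≤ ‖S₁‖ * (‖M‖ * ‖u‖) :=
      (S₁.le_opNorm _).trans (mul_le_mul_of_nonneg_left (M.le_opNorm u) (norm_nonneg _))
    calc ε * (ε * ‖S₁ (M u)‖) ≤ ε * (ε * (‖S₁‖ * (‖M‖ * ‖u‖))) := by gcongr
      _ = ε * ((ε * (‖S₁‖ * ‖M‖)) * ‖u‖) := by ring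
      _ ≤ ε * ((c / 16) * ‖u‖) := by gcongr
      _ = _ := by ring
  have h3 : ‖ε • S₁ e‖ ≤ ‖e‖ := by
    rw [norm_smul, Real.norm_of_nonneg hε.le]
    calc ε * ‖S₁ e‖ ≤ ε * (‖S₁‖ * ‖e‖) := by gcongr; exact S₁.le_opNorm e
      _ = (ε * ‖S₁‖) * ‖e‖ := by ring
      _ ≤ 1 * ‖e‖ := by gcongr
      _ = _ := one_mul _
  have h4 : ‖f‖ ≤ ε * (c / 32) * (2 * ‖u‖) :=
    hs.trans (mul_le_mul_of_nonneg_left hwu (by positivity))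
  calc ‖s‖ ≤ ‖S₀ (u + ε • W u)‖ + (‖S₀ e‖ + (‖ε • ε • S₁ (M u)‖ + (‖ε • S₁ e‖ + ‖f‖))) := by
        rw [hse]
        refine (norm_add_le _ _).trans (add_le_add le_rfl ?_)
        refine (norm_add_le _ _).trans (add_le_add le_rfl ?_)
        exact (norm_add_le _ _).trans (add_le_add le_rfl (norm_add_le _ _))
    _ ≤ _ := by
        rw [hS₀, hS₀]
        linarith

end Linear

/-- Comparison of a curve with the integral of an approximation of its velocity. -/
theorem norm_sub_sub_integral_le {E : Type*} [NormedAddCommGroup E] [NormedSpace ℝ E]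
    [CompleteSpace E] {f f' k : ℝ → E} {T C : ℝ} (hT : 0 ≤ T)
    (hf : ∀ t ∈ Icc 0 T, HasDerivWithinAt f (f' t) (Icc 0 T) t) (hk : ContinuousOn k (Icc 0 T))
    (hb : ∀ t ∈ Icc 0 T, ‖f' t - k t‖ ≤ C) : ‖f T - f 0 - ∫ t in (0 : ℝ)..T, k t‖ ≤ C * T := by
  set k' : ℝ → E := IccExtend hT ((Icc 0 T).domRestrict k) with hk'
  have hkc : Continuous k' := hk.domRestrict.Icc_extend'
  have hkk : ∀ t ∈ Icc 0 T, k' t = k t := fun t ht => IccExtend_of_mem _ _ ht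
  have hint : ∫ t in (0 : ℝ)..T, k t = ∫ t in (0 : ℝ)..T, k' t :=
    intervalIntegral.integral_congr fun t ht => by
      rw [uIcc_of_le hT] at ht
      exact (hkk t ht).symm
  have hd : ∀ t ∈ Icc 0 T, HasDerivWithinAt (fun t => f t - ∫ s in (0 : ℝ)..t, k' s)
      (f' t - k' t) (Icc 0 T) t := fun t ht =>
    (hf t ht).sub (intervalIntegral.integral_hasDerivAt_right (hkc.intervalIntegrable _ _)
      hkc.aestronglyMeasurable.stronglyMeasurableAtFilter hkc.continuousAt).hasDerivWithinAt
  have := (convex_Icc 0 T).norm_image_sub_le_of_norm_hasDerivWithin_le hd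
    (fun t ht => by rw [hkk t ht]; exact hb t ht) (left_mem_Icc.2 hT) (right_mem_Icc.2 hT)
  rw [intervalIntegral.integral_same, sub_zero, sub_zero, Real.norm_of_nonneg hT] at this
  rw [hint]
  convert this using 2
  abel

/-- Fixes the radius before `ε`, so that the remaining smallness conditions concern `ε` alone. -/
theorem exists_closedBall_of_eventually {V : Type*} [PseudoMetricSpace V] {x : V}
    {P : ℝ × V → Prop} (h : ∀ᶠ q in 𝓝[≥] (0 : ℝ) ×ˢ 𝓝 x, P q) :
    ∃ r > 0, ∀ᶠ ε in 𝓝[≥] (0 : ℝ), ∀ y ∈ Metric.closedBall x r, P (ε, y) := by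
  obtain ⟨p, hp, r, hr, hpr⟩ := eventually_prod_iff.1 h
  obtain ⟨R, hR, hball⟩ := Metric.eventually_nhds_iff_ball.1 hr
  refine ⟨R / 2, half_pos hR, ?_⟩
  filter_upwards [hp] with ε hε y hy
  exact hpr hε (hball y (Metric.closedBall_subset_ball (half_lt_self hR) hy))

theorem eventually_mul_lt (K : ℝ) {d : ℝ} (hd : 0 < d) : ∀ᶠ ε in 𝓝[>] (0 : ℝ), ε * K < d := by
  have h : Tendsto (fun ε : ℝ => ε * K) (𝓝[>] 0) (𝓝 (0 * K)) :=
    (Continuous.tendsto (by fun_prop) 0).mono_left nhdsWithin_le_nhds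
  rw [zero_mul] at h
  exact h.eventually_lt_const hd

/-! ### Tubes and first-order expansions for small `ε`. -/

namespace SingleModeSystem

variable {n : ℕ} {H : SingleModeSystem n} {ε₀ : ℝ}
  {S₀ : EuclideanSpace ℝ (Fin n) →L[ℝ] EuclideanSpace ℝ (Fin n)}
  {S₁ : EuclideanSpace ℝ (Fin n) → EuclideanSpace ℝ (Fin n) →L[ℝ] EuclideanSpace ℝ (Fin n)}

/-- The conditions at `q = (ε, y)` that make up a tube. -/
structure TubeCondition (H : SingleModeSystem n) (ε₀ α h sg m C KF η : ℝ)
    (q : ℝ × EuclideanSpace ℝ (Fin n)) : Prop where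
  mem : q.1 ∈ Ico 0 ε₀ ∧ ∀ σ ∈ Icc α (H.x₁ + h), (σ, q.2) ∈ H.X
  speed : ∀ σ ∈ Icc α (H.x₁ + h), |q.1 * H.F₁ q.1 (σ, q.2)| ≤ 1 / 2
  bound : ∀ σ ∈ Icc α (H.x₁ + h), ‖H.relSlope q.1 σ q.2‖ ≤ KF
  linear : ∀ σ ∈ Icc α (H.x₁ + h),
    ∃ D, HasFDerivAt (H.relSlope q.1 σ) D q.2 ∧ ‖D - H.slowDeriv σ‖ ≤ η
  guard : (∀ σ ∈ Icc α (H.x₁ - h / 3), sg * H.γ q.1 (σ, q.2) < 0) ∧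
      0 < sg * H.γ q.1 (H.x₁ + h / 3, q.2) ∧
      ∀ σ ∈ Icc (H.x₁ - h / 3) (H.x₁ + h), ∃ D : ℝ × EuclideanSpace ℝ (Fin n) →L[ℝ] ℝ,
        HasFDerivAt (H.γ q.1) D (σ, q.2) ∧ m ≤ sg * D (1, H.slope q.1 σ q.2) ∧ ‖D‖ ≤ C

/-- The slope is close to the linear map `ε • slowDeriv`. -/
theorem norm_slope_sub_le {α h sg m C KF η ρ ε σ : ℝ}
    (hq : ∀ y ∈ Metric.closedBall H.x₂ (2 * ρ), H.TubeCondition ε₀ α h sg m C KF η (ε, y))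
    (hε : 0 ≤ ε) (hσ : σ ∈ Icc α (H.x₁ + h)) {y z : EuclideanSpace ℝ (Fin n)}
    (hy : y ∈ Metric.closedBall H.x₂ (2 * ρ)) (hz : z ∈ Metric.closedBall H.x₂ (2 * ρ)) :
    ‖H.slope ε σ y - H.slope ε σ z - ε • H.slowDeriv σ (y - z)‖ ≤ ε * (η * ‖y - z‖) := by
  have hlin : ∀ w ∈ Metric.closedBall H.x₂ (2 * ρ),
      ∃ D, HasFDerivAt (H.relSlope ε σ) D w ∧ ‖D - H.slowDeriv σ‖ ≤ η :=
    fun w hw => (hq w hw).linear σ hσ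
  choose! D hD hDη using hlin
  have := (convex_closedBall H.x₂ (2 * ρ)).norm_image_sub_le_of_norm_hasFDerivWithin_le'
    (fun w hw => (hD w hw).hasFDerivWithinAt) hDη hz hy
  rw [slope_eq, slope_eq, ← smul_sub, ← smul_sub, norm_smul, Real.norm_of_nonneg hε]
  exact mul_le_mul_of_nonneg_left this hε

namespace IsAverageable

/-- The tube conditions give a tube. -/
theorem isTube (hH : H.IsAverageable ε₀ S₀ S₁) {α h sg m C KF KA η ρ ε : ℝ} (hα : α < 0)
    (hh : 0 < h) (hhx : h ≤ H.x₁) (hm : 0 < m) (hC : 0 ≤ C) (hρ : 0 < ρ) (hε : 0 ≤ ε)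
    (hKF : 0 ≤ KF) (hη : 0 ≤ η) (hKA : ∀ σ ∈ Icc α (H.x₁ + h), ‖H.slowDeriv σ‖ ≤ KA)
    (hq : ∀ y ∈ Metric.closedBall H.x₂ (2 * ρ), H.TubeCondition ε₀ α h sg m C KF η (ε, y))
    (h1 : ε * KF * (H.x₁ + h - α) ≤ ρ / 8) (h2 : ε * (KA + η) * (H.x₁ + h - α) ≤ 1 / 2) :
    H.IsTube ε α h ρ (ε * KF) (ε * (KA + η)) sg m (|sg| * C) := by
  have hx₂ : H.x₂ ∈ Metric.closedBall H.x₂ (2 * ρ) := Metric.mem_closedBall_self (by linarith)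
  have hεm : ε ∈ Ico 0 ε₀ := (hq _ hx₂).mem.1
  have hx1 := hH.x₁_pos
  have hKA0 : 0 ≤ KA := (norm_nonneg _).trans (hKA 0 ⟨hα.le, by linarith⟩)
  have hsub : Icc α (H.x₁ + h) ×ˢ Metric.closedBall H.x₂ (2 * ρ) ⊆ H.X := fun x hx =>
    (hq x.2 hx.2).mem.2 x.1 hx.1
  have hF₁ : ContDiffOn ℝ 1 (H.F₁ ε) H.X := (hH.contDiffOn_F₁.of_le one_le_two).slice hεm
  have hF₂ : ContDiffOn ℝ 1 (H.F₂ ε) H.X := (hH.contDiffOn_F₂.of_le one_le_two).slice hεm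
  refine
    { α_neg := hα, h_pos := hh, h_le := hhx, isOpen_X := hH.isOpen_X, subset := hsub, m_pos := hm
      contDiffOn_F := (contDiffOn_const.add (contDiffOn_const.mul hF₁)).prodMk
        (hF₂.const_smul ε)
      speed := fun x hx => (hq x.2 hx.2).speed x.1 hx.1
      slow := ⟨by linarith, hρ, by positivity, by positivity, ?_, ?_, ?_, h1, h2⟩
      neg := fun σ hσ y hy => (hq y hy).guard.1 σ hσ
      pos := fun y hy => (hq y hy).guard.2.1
      deriv := fun σ hσ y hy => ?_
      C_nonneg := by positivity
      lipschitz := fun σ hσ y hy z hz => ?_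
      base := hH.mem_guard ε hεm }
  · intro y hy
    have hm : MapsTo (fun σ : ℝ => (σ, y)) (Icc α (H.x₁ + h)) H.X := fun σ hσ => hsub ⟨hσ, hy⟩
    have hc : ContinuousOn (fun σ : ℝ => (σ, y)) (Icc α (H.x₁ + h)) :=
      continuousOn_id.prodMk continuousOn_const
    refine (continuousOn_const.div (continuousOn_const.add (continuousOn_const.mul
      (hF₁.continuousOn.comp hc hm))) fun σ hσ => ?_).smul (hF₂.continuousOn.comp hc hm)
    have := (abs_le.1 ((hq y hy).speed σ hσ)).1
    intro h0
    have h0' : 1 + ε * H.F₁ ε (σ, y) = 0 := h0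
    linarith
  · intro σ hσ y hy
    rw [slope_eq, norm_smul, Real.norm_of_nonneg hε]
    exact mul_le_mul_of_nonneg_left ((hq y hy).bound σ hσ) hε
  · intro σ hσ y hy z hz
    have e1 := norm_slope_sub_le hq hε hσ hy hz
    have e2 : ‖ε • H.slowDeriv σ (y - z)‖ ≤ ε * (KA * ‖y - z‖) := by
      rw [norm_smul, Real.norm_of_nonneg hε]
      exact mul_le_mul_of_nonneg_left ((H.slowDeriv σ).le_of_opNorm_le (hKA σ hσ) _) hε
    have e3 := norm_sub_norm_le (H.slope ε σ y - H.slope ε σ z) (ε • H.slowDeriv σ (y - z))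
    linarith
  · obtain ⟨D, hD, hDm, -⟩ := (hq y hy).guard.2.2 σ hσ
    exact ⟨D, hD, hDm⟩
  · choose! D hD _ hDC using fun w hw => (hq w hw).guard.2.2 σ hσ
    have hcomp : ∀ w ∈ Metric.closedBall H.x₂ (2 * ρ), HasFDerivWithinAt (fun y => H.γ ε (σ, y))
        ((D w).comp (ContinuousLinearMap.inr ℝ ℝ (EuclideanSpace ℝ (Fin n))))
        (Metric.closedBall H.x₂ (2 * ρ)) w := fun w hw =>
      ((hD w hw).comp w (hasFDerivAt_prodMk_right σ w)).hasFDerivWithinAt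
    have hbd : ∀ w ∈ Metric.closedBall H.x₂ (2 * ρ),
        ‖(D w).comp (ContinuousLinearMap.inr ℝ ℝ (EuclideanSpace ℝ (Fin n)))‖ ≤ C := fun w hw => by
      refine (ContinuousLinearMap.opNorm_comp_le _ _).trans ?_
      calc ‖D w‖ * _ ≤ C * 1 := mul_le_mul (hDC w hw)
            (ContinuousLinearMap.norm_inr_le_one ℝ ℝ _) (norm_nonneg _) hC
        _ = C := mul_one C
    have := (convex_closedBall H.x₂ (2 * ρ)).norm_image_sub_le_of_norm_hasFDerivWithin_le
      hcomp hbd hz hy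
    rw [← mul_sub, abs_mul, mul_assoc]
    exact mul_le_mul_of_nonneg_left this (abs_nonneg _)

theorem continuousOn_F₂_zero (hH : H.IsAverageable ε₀ S₀ S₁) {y : EuclideanSpace ℝ (Fin n)}
    (hy : y ∈ H.X₂) : ContinuousOn (fun σ => H.F₂ 0 (σ, y)) H.X₁ :=
  (hH.contDiffOn_F₂.slice hH.zero_mem_Ico).continuousOn.comp
    (continuousOn_id.prodMk continuousOn_const) fun _ hσ => ⟨hσ, hy⟩

theorem Icc_subset (hH : H.IsAverageable ε₀ S₀ S₁) : Icc 0 H.x₁ ⊆ H.X₁ :=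
  hH.ordConnected_X₁.out hH.zero_mem_X₁ hH.x₁_mem

theorem integral_F₂ (hH : H.IsAverageable ε₀ S₀ S₁) :
    ∫ σ in (0 : ℝ)..H.x₁, H.F₂ 0 (σ, H.x₂) = 0 := by
  have := hH.avg_eq_zero
  rw [avg] at this
  exact (smul_eq_zero.1 this).resolve_left (one_div_ne_zero hH.x₁_pos.ne')

/-- Differentiation of the average under the integral. -/
theorem smul_fderiv_avg (hH : H.IsAverageable ε₀ S₀ S₁) :
    H.x₁ • fderiv ℝ H.avg H.x₂ = ∫ σ in (0 : ℝ)..H.x₁, H.slowDeriv σ := by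
  have hx1 := hH.x₁_pos
  have hsub := hH.Icc_subset
  have hι : uIoc 0 H.x₁ ⊆ Icc 0 H.x₁ := by rw [uIoc_of_le hx1.le]; exact Ioc_subset_Icc_self
  have hcA : ContinuousOn H.slowDeriv (uIcc 0 H.x₁) := by
    rw [uIcc_of_le hx1.le]; exact hH.continuousOn_slowDeriv.mono hsub
  -- At `ε = 0`, a value included in `𝓝[≥] 0`, `relSlope` is `F₂`; this supplies the dominating
  -- bound `‖slowDeriv t‖ + 1`.
  obtain ⟨r, hr, hev⟩ := exists_closedBall_of_eventually
    (hH.eventually_hasFDerivAt_relSlope hsub one_pos)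
  have hev0 := hev.self_of_nhdsWithin (mem_Ici.2 le_rfl)
  have hs : Metric.closedBall H.x₂ r ∩ H.X₂ ∈ 𝓝 H.x₂ :=
    inter_mem (Metric.closedBall_mem_nhds _ hr) (hH.isOpen_X₂.mem_nhds hH.x₂_mem)
  have hint : ∀ y ∈ H.X₂, IntervalIntegrable (fun σ => H.F₂ 0 (σ, y)) MeasureTheory.volume 0 H.x₁ :=
    fun y hy => ContinuousOn.intervalIntegrable (by
      rw [uIcc_of_le hx1.le]; exact (hH.continuousOn_F₂_zero hy).mono hsub)
  have hd : ∀ t ∈ Icc 0 H.x₁, ∀ y ∈ Metric.closedBall H.x₂ r ∩ H.X₂,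
      HasFDerivAt (fun y => H.F₂ 0 (t, y)) ((fderiv ℝ (H.F₂ 0) (t, y)).comp
        (ContinuousLinearMap.inr ℝ ℝ (EuclideanSpace ℝ (Fin n)))) y := by
    intro t ht y hy
    have h1 : DifferentiableAt ℝ (H.F₂ 0) (t, y) :=
      ((hH.contDiffOn_F₂.slice hH.zero_mem_Ico).differentiableOn two_ne_zero).differentiableAt
        (hH.isOpen_X.mem_nhds ⟨hsub ht, hy.2⟩)
    exact h1.hasFDerivAt.comp y (hasFDerivAt_prodMk_right t y)
  have key := intervalIntegral.hasFDerivAt_integral_of_dominated_of_fderiv_le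
    (μ := MeasureTheory.volume) (𝕜 := ℝ) (a := 0) (b := H.x₁) (bound := fun t => ‖H.slowDeriv t‖ + 1)
    (F := fun y t => H.F₂ 0 (t, y)) (x₀ := H.x₂)
    (F' := fun y t => (fderiv ℝ (H.F₂ 0) (t, y)).comp
      (ContinuousLinearMap.inr ℝ ℝ (EuclideanSpace ℝ (Fin n)))) hs
    (by
      filter_upwards [hs] with y hy
      exact (intervalIntegrable_iff.1 (hint y hy.2)).aestronglyMeasurable)
    (hint _ hH.x₂_mem) (intervalIntegrable_iff.1 hcA.intervalIntegrable).aestronglyMeasurable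
    (by
      refine Eventually.of_forall fun t ht y hy => ?_
      obtain ⟨D, hD, hDA⟩ := hev0 y hy.1 t (hι ht)
      have hfun : H.relSlope 0 t = fun y => H.F₂ 0 (t, y) := funext fun y => H.relSlope_zero t y
      simp only [hfun] at hD
      rw [(hd t (hι ht) y hy).unique hD]
      have := norm_sub_norm_le D (H.slowDeriv t)
      linarith)
    (hcA.norm.intervalIntegrable.add intervalIntegrable_const)
    (Eventually.of_forall fun t ht y hy => hd t (hι ht) y hy)
  have h2 : HasFDerivAt H.avg ((1 / H.x₁) • ∫ σ in (0 : ℝ)..H.x₁, H.slowDeriv σ) H.x₂ :=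
    key.const_smul (1 / H.x₁)
  rw [h2.fderiv, smul_smul, mul_one_div_cancel hx1.ne', one_smul]

/-- The derivative of the slow reset map is close to `S₀ + ε S₁(x₂*)`. -/
theorem eventually_fderiv_slowReset (hH : H.IsAverageable ε₀ S₀ S₁) {η : ℝ} (hη : 0 < η) :
    ∀ᶠ q in 𝓝[≥] (0 : ℝ) ×ˢ 𝓝 H.x₂, DifferentiableAt ℝ (H.slowReset q.1) q.2 ∧
      ‖fderiv ℝ (H.slowReset q.1) q.2 - (S₀ + q.1 • S₁ H.x₂)‖ ≤ q.1 * η := by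
  obtain ⟨K, hK⟩ := hH.expansion_slowReset.bound
  have h1 : ∀ᶠ q in 𝓝[≥] (0 : ℝ) ×ˢ 𝓝 H.x₂, ‖S₁ q.2 - S₁ H.x₂‖ < η / 2 := by
    have : Tendsto (fun y => ‖S₁ y - S₁ H.x₂‖) (𝓝 H.x₂) (𝓝 ‖S₁ H.x₂ - S₁ H.x₂‖) :=
      (hH.continuousAt_S₁.sub continuousAt_const).norm
    rw [sub_self, norm_zero] at this
    exact tendsto_snd.eventually (this.eventually_lt_const (half_pos hη))
  have h2 : ∀ᶠ q in 𝓝[≥] (0 : ℝ) ×ˢ 𝓝 H.x₂, 0 ≤ q.1 ∧ q.1 * K < η / 2 := by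
    have e1 : ∀ᶠ ε in 𝓝[≥] (0 : ℝ), (0 : ℝ) ≤ ε := self_mem_nhdsWithin
    have e2 : Tendsto (fun ε : ℝ => ε * K) (𝓝[≥] 0) (𝓝 (0 * K)) :=
      (Continuous.tendsto (by fun_prop) 0).mono_left nhdsWithin_le_nhds
    rw [zero_mul] at e2
    exact tendsto_fst.eventually (e1.and (e2.eventually_lt_const (half_pos hη)))
  filter_upwards [hH.differentiableAt_slowReset, hK, h1, h2] with q hd hb h1 h2
  refine ⟨hd, ?_⟩
  have e1 : fderiv ℝ (H.slowReset q.1) q.2 - (S₀ + q.1 • S₁ H.x₂) =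
      (fderiv ℝ (H.slowReset q.1) q.2 - (S₀ + q.1 • S₁ q.2)) + q.1 • (S₁ q.2 - S₁ H.x₂) := by
    rw [smul_sub]; abel
  have e2 : ‖q.1 • (S₁ q.2 - S₁ H.x₂)‖ ≤ q.1 * (η / 2) := by
    rw [norm_smul, Real.norm_of_nonneg h2.1]
    exact mul_le_mul_of_nonneg_left h1.le h2.1
  rw [Real.norm_of_nonneg (sq_nonneg _)] at hb
  have e3 := mul_le_mul_of_nonneg_left h2.2.le h2.1
  rw [e1]
  refine (norm_add_le _ _).trans ?_
  linarith

end IsAverageable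

end SingleModeSystem

namespace SingleModeSystem

variable {n : ℕ} {H : SingleModeSystem n} {ε₀ : ℝ}
  {S₀ : EuclideanSpace ℝ (Fin n) →L[ℝ] EuclideanSpace ℝ (Fin n)}
  {S₁ : EuclideanSpace ℝ (Fin n) → EuclideanSpace ℝ (Fin n) →L[ℝ] EuclideanSpace ℝ (Fin n)}

namespace IsTube

variable {α h ρ B L sg m C ε : ℝ}

/-- The slow reset map fixes the base point. -/
theorem slowReset_base (hT : H.IsTube ε α h ρ B L sg m C)
    (hR : (H.R ε (H.x₁, H.x₂)).2 = H.x₂) : H.slowReset ε H.x₂ = H.x₂ := by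
  obtain ⟨y, hy0, hy⟩ := hT.slow.exists_sol hT.x₁_mem
    (Metric.mem_closedBall_self hT.slow.ρ_pos.le)
  obtain ⟨τ, hτ⟩ := hT.exists_hit hy
  have h1 : H.x₁ = τ := (hT.mem_guard_iff hy hτ hT.x₁_mem).1 (by rw [hy0]; exact hT.base)
  have h2 := hT.slowReset_eq hy hτ
  rwa [← h1, hy0, hR] at h2

theorem Icc_subset (hT : H.IsTube ε α h ρ B L sg m C) : Icc 0 H.x₁ ⊆ Icc α (H.x₁ + h) :=
  Icc_subset_Icc hT.α_neg.le (by linarith [hT.h_pos])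

/-- The first-order expansion of the map from the phase `0` to the phase `x₁*`. -/
theorem norm_sub_sub_le (hT : H.IsTube ε α h ρ B L sg m C) {C' KF KA η : ℝ} (hε : 0 ≤ ε)
    (hη : 0 ≤ η)
    (hA : ContinuousOn H.slowDeriv (Icc 0 H.x₁)) (hKA : ∀ σ ∈ Icc 0 H.x₁, ‖H.slowDeriv σ‖ ≤ KA)
    (hq : ∀ y ∈ Metric.closedBall H.x₂ (2 * ρ), H.TubeCondition ε₀ α h sg m C' KF η (ε, y))
    {y z : ℝ → EuclideanSpace ℝ (Fin n)} (hy : H.IsPhaseSol ε α h ρ y)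
    (hz : H.IsPhaseSol ε α h ρ z) :
    ‖(y H.x₁ - z H.x₁) -
      ((y 0 - z 0) + ε • (∫ σ in (0 : ℝ)..H.x₁, H.slowDeriv σ) (y 0 - z 0))‖ ≤
      ε * (2 * η + KA * (2 * L * (H.x₁ + h - α))) * H.x₁ * ‖y 0 - z 0‖ := by
  have hx1 : 0 ≤ H.x₁ := hT.h_pos.le.trans hT.h_le
  have hsub := hT.Icc_subset
  have hKA0 : 0 ≤ KA := (norm_nonneg _).trans (hKA 0 ⟨le_rfl, hx1⟩)
  set u := y 0 - z 0 with hu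
  -- The velocity of `y - z` is compared with the linear field at the frozen initial difference `u`.
  -- The errors are the nonlinearity, `2 η ‖u‖`, and the drift of `y - z` away from `u`, each times
  -- `ε`.
  have key := norm_sub_sub_integral_le (f := fun σ => y σ - z σ)
    (f' := fun σ => H.slope ε σ (y σ) - H.slope ε σ (z σ)) (k := fun σ => ε • H.slowDeriv σ u)
    (T := H.x₁) (C := ε * (2 * η + KA * (2 * L * (H.x₁ + h - α))) * ‖u‖) hx1
    (fun σ hσ => ((hy σ (hsub hσ)).2.mono hsub).sub ((hz σ (hsub hσ)).2.mono hsub))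
    ((hA.clm_apply continuousOn_const).const_smul ε)
    (fun σ hσ => by
      have e1 := norm_slope_sub_le hq hε (hsub hσ) (hy σ (hsub hσ)).1 (hz σ (hsub hσ)).1
      obtain ⟨e2, e3⟩ := hT.slow.dist_sol_le hy hz hT.zero_mem (hsub hσ)
      have e4 : ‖ε • H.slowDeriv σ ((y σ - z σ) - u)‖ ≤
          ε * (KA * (2 * L * (H.x₁ + h - α) * ‖u‖)) := by
        rw [norm_smul, Real.norm_of_nonneg hε]
        refine mul_le_mul_of_nonneg_left ?_ hε
        exact ((H.slowDeriv σ).le_of_opNorm_le (hKA σ hσ) _).trans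
          (mul_le_mul_of_nonneg_left e3 hKA0)
      have e5 : ε * (η * ‖y σ - z σ‖) ≤ ε * (η * (2 * ‖u‖)) := by gcongr
      have e6 : H.slope ε σ (y σ) - H.slope ε σ (z σ) - ε • H.slowDeriv σ u =
          (H.slope ε σ (y σ) - H.slope ε σ (z σ) - ε • H.slowDeriv σ (y σ - z σ)) +
          ε • H.slowDeriv σ ((y σ - z σ) - u) := by
        rw [map_sub (H.slowDeriv σ) (y σ - z σ) u, smul_sub]; abel
      rw [e6]
      refine (norm_add_le _ _).trans ?_
      linarith)
  have hint : ∫ σ in (0 : ℝ)..H.x₁, ε • H.slowDeriv σ u =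
      ε • (∫ σ in (0 : ℝ)..H.x₁, H.slowDeriv σ) u := by
    rw [intervalIntegral.integral_smul, ContinuousLinearMap.intervalIntegral_apply]
    refine ContinuousOn.intervalIntegrable ?_
    rwa [uIcc_of_le hx1]
  rw [hint] at key
  simp only [← hu] at key
  rw [← sub_sub]
  refine key.trans (le_of_eq ?_)
  ring

/-- The trajectory of `(0, x₂*)` nearly returns to `x₂*` at the phase `x₁*`. -/
theorem norm_base_sub_le (hT : H.IsTube ε α h ρ B L sg m C) {η r : ℝ} (hε : 0 ≤ ε)
    (hF : ContinuousOn (fun σ => H.F₂ 0 (σ, H.x₂)) (Icc 0 H.x₁))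
    (hF0 : ∫ σ in (0 : ℝ)..H.x₁, H.F₂ 0 (σ, H.x₂) = 0)
    (hq : ∀ y ∈ Metric.closedBall H.x₂ r, ∀ σ ∈ Icc α (H.x₁ + h),
      ‖H.relSlope ε σ y - H.F₂ 0 (σ, H.x₂)‖ < η)
    (hr : B * (H.x₁ + h - α) ≤ r) {y : ℝ → EuclideanSpace ℝ (Fin n)}
    (hy : H.IsPhaseSol ε α h ρ y) (hy0 : y 0 = H.x₂) :
    ‖y H.x₁ - H.x₂‖ ≤ ε * η * H.x₁ := by
  have hx1 : 0 ≤ H.x₁ := hT.h_pos.le.trans hT.h_le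
  have hsub := hT.Icc_subset
  -- With the slow variable frozen at `x₂` the integral over one period vanishes. The drift bound
  -- keeps `y` in the ball of radius `r`, where freezing costs at most `ε η`.
  have key := norm_sub_sub_integral_le (f := y) (f' := fun σ => H.slope ε σ (y σ))
    (k := fun σ => ε • H.F₂ 0 (σ, H.x₂)) (T := H.x₁) (C := ε * η) hx1
    (fun σ hσ => (hy σ (hsub hσ)).2.mono hsub) (hF.const_smul ε)
    (fun σ hσ => by
      have e1 := hT.slow.norm_sub_le hy hT.zero_mem (hsub hσ)
      have e2 : |σ - 0| ≤ H.x₁ + h - α := by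
        rw [sub_zero, abs_of_nonneg hσ.1]
        linarith [hσ.2, hT.h_pos, hT.α_neg]
      have e3 : y σ ∈ Metric.closedBall H.x₂ r := by
        rw [mem_closedBall_iff_norm, ← hy0]
        exact e1.trans ((mul_le_mul_of_nonneg_left e2 hT.slow.B_nonneg).trans hr)
      rw [slope_eq, ← smul_sub, norm_smul, Real.norm_of_nonneg hε]
      exact mul_le_mul_of_nonneg_left (hq _ e3 σ (hsub hσ)).le hε)
  rwa [intervalIntegral.integral_smul, hF0, smul_zero, sub_zero, hy0] at key

end IsTube

end SingleModeSystem

/-! ### The choice of the constants. -/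

theorem mainTheorem3 {n : ℕ} (H : SingleModeSystem n) (ε₀ : ℝ)
    (S₀ : EuclideanSpace ℝ (Fin n) →L[ℝ] EuclideanSpace ℝ (Fin n))
    (S₁ : EuclideanSpace ℝ (Fin n) → EuclideanSpace ℝ (Fin n) →L[ℝ] EuclideanSpace ℝ (Fin n))
    (hH : H.IsAverageable ε₀ S₀ S₁) (hS : H.HasOrthogonalReset S₀ S₁)
    (hW : ∀ v : EuclideanSpace ℝ (Fin n), v ≠ 0 →
      inner ℝ v ((ContinuousLinearMap.adjoint (H.W S₀ S₁) + H.W S₀ S₁) v) < 0) :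
    ∃ ε₁ > 0, ∀ ε ∈ Set.Ioo 0 ε₁,
      ∃ Γ, H.IsPeriodicOrbit ε Γ ∧ H.IsExponentiallyStable ε Γ := by
  have hx1 := hH.x₁_pos
  obtain ⟨α, h, sg, m, hα, hh, hhx, hX₁, hm, hneg, hpos, hder⟩ := hH.exists_guard_constants
  obtain ⟨C, hC, hguard⟩ := hH.eventually_guard hα hh hhx hX₁ hm hneg hpos hder
  set J := H.x₁ + h - α with hJ
  have hJpos : 0 < J := by rw [hJ]; linarith
  have hsub : Icc 0 H.x₁ ⊆ Icc α (H.x₁ + h) := Icc_subset_Icc hα.le (by linarith)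
  obtain ⟨KF, hKF⟩ := isCompact_Icc.exists_bound_of_continuousOn
    ((hH.continuousOn_F₂_zero hH.x₂_mem).mono hX₁)
  obtain ⟨KA, hKA⟩ := isCompact_Icc.exists_bound_of_continuousOn
    (hH.continuousOn_slowDeriv.mono hX₁)
  have hKF0 : 0 ≤ KF := (norm_nonneg _).trans (hKF 0 (hsub ⟨le_rfl, hx1.le⟩))
  have hKA0 : 0 ≤ KA := (norm_nonneg _).trans (hKA 0 (hsub ⟨le_rfl, hx1.le⟩))
  set W := H.W S₀ S₁ with hWdef
  set M := ∫ σ in (0 : ℝ)..H.x₁, H.slowDeriv σ with hM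
  obtain ⟨c', hc'0, hc'⟩ := exists_inner_le_neg_mul_sq hW
  -- The quadratic form of `Wᵀ + W` is twice that of `W`.
  set c := c' / 2 with hcdef
  have hc0 : 0 < c := half_pos hc'0
  have hc : ∀ v, inner ℝ v (W v) ≤ -c * ‖v‖ ^ 2 := fun v => by
    have h1 := hc' v
    rw [add_apply, inner_add_right, ContinuousLinearMap.adjoint_inner_right, real_inner_comm] at h1
    rw [hcdef]
    linarith
  have hS₀ : ∀ v, ‖S₀ v‖ = ‖v‖ := ContinuousLinearMap.norm_map_of_mem_unitary hS.orthogonal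
  have hSW : ∀ v, S₀ (W v) = S₁ H.x₂ v + S₀ (M v) := fun v => by
    have h1 : S₀ * ContinuousLinearMap.adjoint S₀ = 1 := Unitary.mul_star_self_of_mem hS.orthogonal
    have h2 : ∀ w, S₀ (ContinuousLinearMap.adjoint S₀ w) = w := fun w => by
      have := congrArg (fun T => T w) h1
      simpa using this
    rw [hWdef, SingleModeSystem.W, hH.smul_fderiv_avg, add_apply, map_add,
      mul_apply_eq_comp, h2]
  -- The first bound is the error allowed for the slow reset map; the second makes `2 η x₁` half of
  -- the error `c / 16` allowed for the flow, the other half being the drift term, small with `ε`.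
  set η := min (c / 32) (c / (64 * H.x₁)) with hηdef
  have hη : 0 < η := lt_min (by positivity) (by positivity)
  have hη1 : η ≤ c / 32 := min_le_left _ _
  have hη2 : 2 * η * H.x₁ ≤ c / 32 := by
    have h1 : η ≤ c / (64 * H.x₁) := min_le_right _ _
    have h2 := mul_le_mul_of_nonneg_right h1 hx1.le
    have h3 : c / (64 * H.x₁) * H.x₁ = c / 64 := by field_simp
    linarith
  -- the conditions that hold on a fixed neighbourhood of the base point
  have hev : ∀ᶠ q in 𝓝[≥] (0 : ℝ) ×ˢ 𝓝 H.x₂,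
      H.TubeCondition ε₀ α h sg m C (KF + 1) η q ∧ DifferentiableAt ℝ (H.slowReset q.1) q.2 ∧
      ‖fderiv ℝ (H.slowReset q.1) q.2 - (S₀ + q.1 • S₁ H.x₂)‖ ≤ q.1 * η := by
    filter_upwards [hH.eventually_mem_X hX₁, hH.eventually_speed hX₁,
      hH.eventually_relSlope hX₁ one_pos, hH.eventually_hasFDerivAt_relSlope hX₁ hη, hguard,
      hH.eventually_fderiv_slowReset hη] with q h1 h2 h3 h4 h5 h6
    refine ⟨⟨h1, h2, fun σ hσ => ?_, h4, h5⟩, h6⟩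
    have e1 := norm_sub_norm_le (H.relSlope q.1 σ q.2) (H.F₂ 0 (σ, H.x₂))
    linarith [h3 σ hσ, hKF σ hσ]
  obtain ⟨r, hr, hev⟩ := exists_closedBall_of_eventually hev
  set ρ := r / 2 with hρdef
  have hρ : 0 < ρ := half_pos hr
  have h2ρ : 2 * ρ = r := by rw [hρdef]; ring
  rw [← h2ρ] at hev
  -- This accuracy depends on the fixed `ρ`: the return map moves `x₂` by at most `3 ε η₂ x₁ = (ε c
  -- / 4) (ρ / 2)`, exactly what the contraction principle allows. The ball of radius `r₂` may be
  -- smaller, since only the trajectory from `x₂` must stay in it.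
  have hη₂ : 0 < c * ρ / (24 * H.x₁) := by positivity
  obtain ⟨r₂, hr₂, hev₂⟩ := exists_closedBall_of_eventually (hH.eventually_relSlope hX₁ hη₂)
  have hpre : 𝓝[>] (0 : ℝ) ≤ 𝓝[≥] 0 := nhdsWithin_mono _ Ioi_subset_Ici_self
  have hfinal : ∀ᶠ ε in 𝓝[>] (0 : ℝ),
      ∃ Γ, H.IsPeriodicOrbit ε Γ ∧ H.IsExponentiallyStable ε Γ := by
    filter_upwards [hpre hev, hpre hev₂, self_mem_nhdsWithin,
      eventually_mul_lt ((KF + 1) * J) (d := ρ / 8) (by positivity),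
      eventually_mul_lt ((KF + 1) * J) hr₂,
      eventually_mul_lt ((KA + η) * J) (half_pos one_pos),
      eventually_mul_lt c one_pos, eventually_mul_lt (‖W‖ ^ 2) hc0,
      eventually_mul_lt ‖S₁ H.x₂‖ one_pos,
      eventually_mul_lt (‖S₁ H.x₂‖ * ‖M‖) (d := c / 16) (by positivity),
      eventually_mul_lt (KA * (2 * (KA + η) * J) * H.x₁) (d := c / 32) (by positivity)]
      with ε hq hq₂ hε hs1 hs2 hs3 hs4 hs5 hs6 hs7 hs8
    have hε : 0 < ε := hε
    have hT := hH.isTube hα hh hhx hm hC hρ hε.le (by linarith) hη.le hKA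
      (fun y hy => (hq y hy).1) (by linarith) (by linarith)
    have hεm : ε ∈ Ico 0 ε₀ :=
      (hq H.x₂ (Metric.mem_closedBall_self (by linarith))).1.mem.1
    -- the slow reset map is nearly `S₀ + ε S₁`
    have hslow : ∀ a ∈ Metric.closedBall H.x₂ (2 * ρ), ∀ b ∈ Metric.closedBall H.x₂ (2 * ρ),
        ‖H.slowReset ε a - H.slowReset ε b - (S₀ + ε • S₁ H.x₂) (a - b)‖ ≤
          ε * (c / 32) * ‖a - b‖ := fun a ha b hb => by
      refine ((convex_closedBall H.x₂ (2 * ρ)).norm_image_sub_le_of_norm_hasFDerivWithin_le'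
        (fun w hw => (hq w hw).2.1.hasFDerivAt.hasFDerivWithinAt) (fun w hw => (hq w hw).2.2)
        hb ha).trans ?_
      gcongr
    refine hT.exists_stable (q := 1 - ε * (c / 4)) (hH.fst_R ε hεm) (by linarith)
      (by linarith [mul_pos hε hc0]) ?_ ?_
    · intro y z hy hz _ _
      have hyz := hT.norm_sub_sub_le hε.le hη.le (hH.continuousOn_slowDeriv.mono hH.Icc_subset)
        (fun σ hσ => hKA σ (hsub hσ)) (fun y hy => (hq y hy).1) hy hz
      have hw : ‖(y H.x₁ - z H.x₁) - ((y 0 - z 0) + ε • M (y 0 - z 0))‖ ≤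
          ε * (c / 16) * ‖y 0 - z 0‖ := by
        refine hyz.trans (mul_le_mul_of_nonneg_right ?_ (norm_nonneg _))
        rw [mul_assoc]
        refine mul_le_mul_of_nonneg_left ?_ hε.le
        linarith
      have hx := hT.x₁_mem
      refine norm_le_of_first_order hS₀ hSW hc hc0 hε hs4.le hs5.le hs6.le hs7.le hw
        (hslow _ (hy _ hx).1 _ (hz _ hx).1) ?_
      exact (hT.slow.dist_sol_le hy hz hT.zero_mem hx).1
    · intro y hy hy0
      have h1 := hT.norm_base_sub_le hε.le
        ((hH.continuousOn_F₂_zero hH.x₂_mem).mono hH.Icc_subset) hH.integral_F₂ hq₂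
        (by linarith) hy hy0
      have h2 := hslow _ (hy _ hT.x₁_mem).1 H.x₂ (Metric.mem_closedBall_self (by linarith))
      rw [hT.slowReset_base (hH.snd_R ε hεm)] at h2
      set w := y H.x₁ - H.x₂ with hwdef
      have h3 : ‖(S₀ + ε • S₁ H.x₂) w‖ ≤ 2 * ‖w‖ := by
        rw [add_apply, smul_apply]
        refine (norm_add_le _ _).trans ?_
        rw [hS₀, norm_smul, Real.norm_of_nonneg hε.le]
        have e1 := mul_le_mul_of_nonneg_left ((S₁ H.x₂).le_opNorm w) hε.le
        have e2 := mul_le_mul_of_nonneg_right hs6.le (norm_nonneg w)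
        linarith
      have h4 := norm_sub_norm_le (H.slowReset ε (y H.x₁) - H.x₂) ((S₀ + ε • S₁ H.x₂) w)
      have h5 : ε * (c / 32) * ‖w‖ ≤ 1 * ‖w‖ :=
        mul_le_mul_of_nonneg_right (by linarith) (norm_nonneg _)
      have h6 : ε * (c * ρ / (24 * H.x₁)) * H.x₁ = ε * (c * ρ / 24) := by field_simp
      have h7 : (1 - (1 - ε * (c / 4))) * (ρ / 2) = 3 * (ε * (c * ρ / 24)) := by ring
      rw [h7]
      linarith
  obtain ⟨ε₁, hε₁, hsubset⟩ := mem_nhdsGT_iff_exists_Ioo_subset.1 hfinal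
  exact ⟨ε₁, hε₁, fun ε hε => hsubset hε⟩
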